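/- Let $E$ be a finite-dimensional real vector space with a norm $\|\cdot\|$ and dual norm $\|\cdot\|_*$, let $Q\subset E$ be convex and compact, and let $\xi$ be a random variable such that $f(\cdot,\xi)$ is almost surely a closed convex function on $Q$ and $f(x):=\mathbb E_\xi f(x,\xi)$ is finite on $Q$. Let $x_*\in Q$ minimize $f$ over $Q$ and $f_*=f(x_*)$. Suppose that for every $x\in Q$ a stochastic subgradient $\nabla_x f(x,\xi)\in E^*$ is given (measurable in $(x,\xi)$) with $$\mathbb E_\xi[\nabla_x f(x,\xi)]\in\partial f(x),\qquad \mathbb E_\xi\|\nabla_x f(x,\xi)\|_*^2\le M^2,\qquad M>0 .$$ Let $d$ be differentiable on $Q$ and $1$-strongly convex on $Q$ with respect to $\|\cdot\|$, let $V_z(x)=d(x)-d(z)-\langle\nabla d(z),x-z\rangle$ and $x^0=\arg\min_{x\in Q}d(x)$, and let $0<R\le\bar R$ satisfy $V_{x^0}(x_*)\le R^2$ and $\max_{x\in Q}V_x(x_*)\le\bar R^2$. Stochastic Mirror Descent (SMD) with $N$ steps takes an i.i.d. sample $\xi^0,\xi^1,\dots$ of $\xi$, iterates $$x^{k+1}=\arg\min_{x\in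 Q}\big\{h\langle\nabla_xf(x^k,\xi^k),x-x^k\rangle+V_{x^k}(x)\big\},\qquad h=\frac RM\sqrt{\frac2N},$$ and outputs $\bar x^N=\frac1N\sum_{k=0}^{N-1}x^k$; it uses no value of $f$. **Theorem.** There are constants $C_a,C_b>0$, which are absolute, and $C_c(\alpha)>0$, which depends only on $\alpha>2$, such that the following holds for every problem as above, every $\varepsilon>0$ and every $\sigma\in(0,1)$. Let one of the following assumptions hold, with the indicated value of $C$, and let $N=\lceil 4CM^2\bar R^2/\varepsilon^2\rceil$ and $K=\lceil 2\ln(1/\sigma)\rceil$: (a) $C=C_a$, and for every $x\in Q$, $\|\nabla_xf(x,\xi)\|_*\le M$ almost surely; (b) $C=C_b$, for every $x\in Q$, $\mathbb E_\xi\exp\big(\|\nabla_xf(x,\xi)\|_*^2/M^2\big)\le e$, and $\ln(1/\sigma)\le N$; (c) $C=C_c(\alpha)$ for some $\alpha>2$, for every $x\in Q$ and $t\ge0$, $\mathbb P\big(\|\nabla_xf(x,\xi)\|_*^2/M^2\ge t\big)\le(t+1)^{-\alpha}$, and $\sigma^{-1/(\alpha-1)}\le N$. If $\bar x^{N,1},\dots,\bar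 x^{N,K}$ are independent outputs of SMD with $N$ steps, then $\bar x^K=\frac1K\sum_{i=1}^K\bar x^{N,i}$ lies in $Q$ and is an $(\varepsilon,\sigma)$-solution: $$\mathbb P\{f(\bar x^K)-f_*\ge\varepsilon\}\le\sigma .$$ -/

import Mathlib

open MeasureTheory ProbabilityTheory
open scoped ENNReal

universe u v w

/-- The objective `f(x) = 𝔼_ξ f(x, ξ)`, where `P` is the law of `ξ` and `F x ξ` is `f(x, ξ)`. -/
noncomputable def objective {E : Type u} {Ξ : Type v} [MeasurableSpace Ξ]
    (P : Measure Ξ) (F : E → Ξ → ℝ) (x : E) : ℝ :=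
  ∫ ξ, F x ξ ∂P

/-- Standing assumptions on the stochastic problem `min_{x ∈ Q} 𝔼_ξ f(x, ξ)`: the set `Q` is convex
and compact, `f(·, ξ)` is closed (lower semicontinuous) and convex on `Q` for a.e. `ξ`, and the
expectation exists at every point of `Q`. -/
structure IsStochasticProblem {E : Type u} {Ξ : Type v} [NormedAddCommGroup E] [NormedSpace ℝ E]
    [MeasurableSpace Ξ] (Q : Set E) (P : Measure Ξ) (F : E → Ξ → ℝ) : Prop where
  convex_set : Convex ℝ Q
  compact_set : IsCompact Q
  integrable : ∀ x ∈ Q, Integrable (fun ξ => F x ξ) P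
  convex : ∀ᵐ ξ ∂P, ConvexOn ℝ Q (fun x => F x ξ)
  closed : ∀ᵐ ξ ∂P, LowerSemicontinuousOn (fun x => F x ξ) Q

/-- The subdifferential at `x` of a function `f` on the feasible set `Q`. -/
def subdifferentialOn {E : Type u} [NormedAddCommGroup E] [NormedSpace ℝ E]
    (Q : Set E) (f : E → ℝ) (x : E) : Set (StrongDual ℝ E) :=
  {g | ∀ y ∈ Q, f x + g (y - x) ≤ f y}

/-- `G x ξ` is a stochastic subgradient of `f` on `Q` with second moment at most `M ^ 2`.
The norm on `StrongDual ℝ E` is the norm conjugate to the norm of `E`. -/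
structure IsStochasticSubgradient {E : Type u} {Ξ : Type v} [NormedAddCommGroup E]
    [NormedSpace ℝ E] [MeasurableSpace E] [MeasurableSpace Ξ]
    (Q : Set E) (P : Measure Ξ) (f : E → ℝ) (G : E → Ξ → StrongDual ℝ E) (M : ℝ) : Prop where
  measurable : Measurable (fun p : E × Ξ => G p.1 p.2)
  mean_mem : ∀ x ∈ Q, ∫ ξ, G x ξ ∂P ∈ subdifferentialOn Q f x
  second_moment : ∀ x ∈ Q, ∫⁻ ξ, ENNReal.ofReal (‖G x ξ‖ ^ 2) ∂P ≤ ENNReal.ofReal (M ^ 2)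

/-- A prox-function on `Q`: differentiable and 1-strongly convex with respect to the norm. -/
structure IsProxFunction {E : Type u} [NormedAddCommGroup E] [NormedSpace ℝ E]
    (Q : Set E) (d : E → ℝ) : Prop where
  differentiable : DifferentiableOn ℝ d Q
  strongly_convex : StrongConvexOn Q 1 d

/-- Bregman's divergence `V_z(x) = d(x) - d(z) - ⟨∇d(z), x - z⟩`. For `x, z` in the convex set `Q`
and `d` differentiable on `Q`, the last term is the derivative of `d` at `z` in the direction
`x - z`, whichever derivative within `Q` is used. -/
noncomputable def bregman {E : Type u} [NormedAddCommGroup E] [NormedSpace ℝ E]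
    (Q : Set E) (d : E → ℝ) (z x : E) : ℝ :=
  d x - d z - fderivWithin ℝ d Q z (x - z)

/-- `y = Mirr_z(v)`, that is, `y` minimizes `⟨v, x - z⟩ + V_z(x)` over `x ∈ Q`. -/
def IsMirr {E : Type u} [NormedAddCommGroup E] [NormedSpace ℝ E]
    (Q : Set E) (d : E → ℝ) (z : E) (v : StrongDual ℝ E) (y : E) : Prop :=
  y ∈ Q ∧ IsMinOn (fun x => v (x - z) + bregman Q d z x) Q y

/-- `x` is the sequence of (random) iterates of Stochastic Mirror Descent with step size `h`,
starting point `x₀` and the i.i.d. sample `ξ` of the law `P`. -/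
structure IsSMDRun {E : Type u} {Ξ : Type v} {Ω : Type w} [NormedAddCommGroup E] [NormedSpace ℝ E]
    [MeasurableSpace E] [MeasurableSpace Ξ] [MeasurableSpace Ω]
    (μ : Measure Ω) (Q : Set E) (P : Measure Ξ) (d : E → ℝ) (G : E → Ξ → StrongDual ℝ E)
    (h : ℝ) (x₀ : E) (ξ : ℕ → Ω → Ξ) (x : ℕ → Ω → E) : Prop where
  measurable_sample : ∀ k, Measurable (ξ k)
  law_sample : ∀ k, μ.map (ξ k) = P
  indep_sample : iIndepFun ξ μ
  measurable_iterate : ∀ k, Measurable (x k)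
  start : ∀ ω, x 0 ω = x₀
  step : ∀ k ω, IsMirr Q d (x k ω) (h • G (x k ω) (ξ k ω)) (x (k + 1) ω)

/-- The output `(1 / N) ∑_{k < N} x^k` of a run with `N` steps. -/
noncomputable def smdOutput {E : Type u} {Ω : Type w} [NormedAddCommGroup E] [NormedSpace ℝ E]
    (x : ℕ → Ω → E) (N : ℕ) (ω : Ω) : E :=
  (1 / (N : ℝ)) • ∑ k ∈ Finset.range N, x k ω

/-- Tail assumption (a): almost surely bounded stochastic subgradients. -/
def TailBounded {E : Type u} {Ξ : Type v} [NormedAddCommGroup E] [NormedSpace ℝ E]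
    [MeasurableSpace Ξ] (Q : Set E) (P : Measure Ξ) (G : E → Ξ → StrongDual ℝ E) (M : ℝ) : Prop :=
  ∀ x ∈ Q, ∀ᵐ ξ ∂P, ‖G x ξ‖ ≤ M

/-- Tail assumption (b): light tails. -/
def TailLight {E : Type u} {Ξ : Type v} [NormedAddCommGroup E] [NormedSpace ℝ E]
    [MeasurableSpace Ξ] (Q : Set E) (P : Measure Ξ) (G : E → Ξ → StrongDual ℝ E) (M : ℝ) : Prop :=
  ∀ x ∈ Q, ∫⁻ ξ, ENNReal.ofReal (Real.exp (‖G x ξ‖ ^ 2 / M ^ 2)) ∂P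
    ≤ ENNReal.ofReal (Real.exp 1)

/-- Tail assumption (c): polynomial tails with exponent `α`. -/
def TailPolynomial {E : Type u} {Ξ : Type v} [NormedAddCommGroup E] [NormedSpace ℝ E]
    [MeasurableSpace Ξ] (Q : Set E) (P : Measure Ξ) (G : E → Ξ → StrongDual ℝ E) (M : ℝ)
    (α : ℝ) : Prop :=
  ∀ x ∈ Q, ∀ t : ℝ, 0 ≤ t →
    P {ξ | t ≤ ‖G x ξ‖ ^ 2 / M ^ 2} ≤ ENNReal.ofReal (1 / (t + 1) ^ α)

/-- The random point `y` is an `(ε, σ)`-solution of `min_{x ∈ Q} f(x)`: it is feasible and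
`ℙ{f(y) - f_* ≥ ε} ≤ σ`, where `f_*` is the optimal value. -/
def IsEpsSigmaSolution {E : Type u} {Ω : Type w} [MeasurableSpace Ω]
    (μ : Measure Ω) (Q : Set E) (f : E → ℝ) (ε σ : ℝ) (y : Ω → E) : Prop :=
  (∀ ω, y ω ∈ Q) ∧ μ {ω | f (y ω) - sInf (f '' Q) ≥ ε} ≤ ENNReal.ofReal σ

/-!
Let `f` be the objective, `x*` a minimizer, `S_k = ‖G(x^k, ξ^k)‖² / M²`, and let `D_k` be the error
of the `k`-th stochastic subgradient in the direction `x^k - x*`, divided by `M Rbar`. Strong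
convexity gives `‖x^k - x*‖ ≤ √2 Rbar`, hence `|D_k| ≤ √2 (1 + √S_k)`, and telescoping the mirror
steps bounds the normalised gap `Y = √N (f(x̄^N) - f(x*)) / (M Rbar)` by
`1 + ∑_{k < N} (S_k / N + D_k / √N)` (`normalized_gap_le`).

Given the past, `D_k` has mean zero and `S_k` has mean at most one. Hence the conditional
expectation of `exp ((S_k / N + D_k / √N) / 16)`, restricted to `S_k ≤ τ`, is `1 + O(1 / N)`,
provided the values `S_k` between `N` and `τ` contribute only `O(1 / N)`
(`lintegral_exp_step_le`). Multiplying along the run, `exp (Y / 16)` has expectation `O(1)` on the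
event that no `S_k` exceeds `τ` (`IsSMDRun.lintegral_exp_gap_le`). The product is taken by
successive conditioning, which requires that `x^k` be a measurable function of the sample before
time `k`; this holds because the mirror step is a unique minimizer
(`measurable_of_unique_isMinOn`, `IsSMDRun.measurable_pastSample`).

Each tail assumption allows a level `τ` that is exceeded during a run with probability at most
`σ / (4 K)` (`TailControlled`). Bounded subgradients are a case of light tails, for which `τ` may be
taken large. For polynomial tails `τ = 2 K N` works, because `exp (K / 2)` is of order
`1 / σ ≤ N ^ (α - 1)`.

By Jensen's inequality the gap of the averaged point is at most the average of the gaps of the `K`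
independent outputs. A Chernoff bound for the variables `Y i` truncated at a multiple of `K`, with a
union bound for the truncation, shows that their average exceeds `3520` with probability at most `σ`
(`measure_sum_ge_le`). The choice of `N` with `C = 1760 ^ 2` makes `ε` correspond to at least `3520`
on the normalised scale. The same constant serves all three assumptions.
-/

/-! ### Bregman divergence and the mirror step -/

section Deterministic

variable {E : Type*} [NormedAddCommGroup E] [NormedSpace ℝ E] {Q : Set E} {d : E → ℝ}

/-- The derivative within a convex set, evaluated at a direction pointing into the set, is the
one-sided directional derivative, whichever derivative within the set is chosen. -/
lemma hasDerivWithinAt_segment (hQ : Convex ℝ Q) (hd : DifferentiableOn ℝ d Q) {z x : E}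
    (hz : z ∈ Q) (hx : x ∈ Q) :
    HasDerivWithinAt (fun t : ℝ => d (z + t • (x - z))) (fderivWithin ℝ d Q z (x - z))
      (Set.Icc 0 1) 0 := by
  have h1 : HasDerivWithinAt (fun t : ℝ => z + t • (x - z)) (x - z) (Set.Icc 0 1) 0 := by
    have := ((hasDerivAt_id (0 : ℝ)).smul_const (x - z)).const_add z
    simpa using this.hasDerivWithinAt
  have h2 : HasFDerivWithinAt d (fderivWithin ℝ d Q z) Q (z + (0 : ℝ) • (x - z)) := by
    simpa using (hd z hz).hasFDerivWithinAt
  refine h2.comp_hasDerivWithinAt (0 : ℝ) h1 fun t ht => ?_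
  exact hQ.add_smul_sub_mem hz hx ht

lemma tendsto_segment_slope (hQ : Convex ℝ Q) (hd : DifferentiableOn ℝ d Q) {z x : E}
    (hz : z ∈ Q) (hx : x ∈ Q) :
    Filter.Tendsto (fun t : ℝ => (d (z + t • (x - z)) - d z) / t) (nhdsWithin 0 (Set.Ioi 0))
      (nhds (fderivWithin ℝ d Q z (x - z))) := by
  have h := hasDerivWithinAt_iff_tendsto_slope.1 (hasDerivWithinAt_segment hQ hd hz hx)
  have hle : nhdsWithin (0 : ℝ) (Set.Ioi 0) ≤ nhdsWithin 0 (Set.Icc 0 1 \ {0}) := by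
    rw [← nhdsWithin_Ioc_eq_nhdsGT (zero_lt_one' ℝ)]
    exact nhdsWithin_mono _ fun t ht => ⟨⟨ht.1.le, ht.2⟩, ht.1.ne'⟩
  refine (h.mono_left hle).congr fun t => ?_
  simp [slope_def_field]

lemma eventually_mem_Ioc : ∀ᶠ t : ℝ in nhdsWithin 0 (Set.Ioi 0), t ∈ Set.Ioc (0 : ℝ) 1 := by
  rw [← nhdsWithin_Ioc_eq_nhdsGT (zero_lt_one' ℝ)]
  exact self_mem_nhdsWithin

lemma half_sq_norm_le_bregman (hQ : Convex ℝ Q) (hd : IsProxFunction Q d) {z x : E}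
    (hz : z ∈ Q) (hx : x ∈ Q) : ‖x - z‖ ^ 2 / 2 ≤ bregman Q d z x := by
  have h1 := tendsto_segment_slope hQ hd.differentiable hz hx
  have h2 : Filter.Tendsto (fun t : ℝ => d x - d z - (1 - t) * (‖x - z‖ ^ 2 / 2))
      (nhdsWithin 0 (Set.Ioi 0)) (nhds (d x - d z - (1 - 0) * (‖x - z‖ ^ 2 / 2))) := by
    refine Filter.Tendsto.mono_left ?_ nhdsWithin_le_nhds
    exact Continuous.tendsto (by fun_prop) 0
  have h3 := le_of_tendsto_of_tendsto h1 h2 (by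
    filter_upwards [eventually_mem_Ioc] with t ht
    have := hd.strongly_convex.2 hx hz ht.1.le (sub_nonneg.2 ht.2) (by ring)
    have e : t • x + (1 - t) • z = z + t • (x - z) := by module
    rw [e] at this
    rw [div_le_iff₀ ht.1]
    simp only [smul_eq_mul] at this
    linarith)
  unfold bregman
  linarith

lemma norm_sub_le_of_bregman_le (hQ : Convex ℝ Q) (hd : IsProxFunction Q d) {z x : E} {r : ℝ}
    (hr : 0 ≤ r) (hz : z ∈ Q) (hx : x ∈ Q) (h : bregman Q d z x ≤ r ^ 2) :
    ‖z - x‖ ≤ Real.sqrt 2 * r := by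
  have := half_sq_norm_le_bregman hQ hd hz hx
  rw [norm_sub_rev]
  refine abs_le_of_sq_le_sq' ?_ (by positivity) |>.2
  rw [mul_pow, Real.sq_sqrt (by norm_num)]
  linarith

/-- The three-point inequality: first-order optimality of the mirror step `y`. -/
lemma IsMirr.apply_sub_le (hQ : Convex ℝ Q) (hd : IsProxFunction Q d) {z y x : E}
    {v : StrongDual ℝ E} (hy : IsMirr Q d z v y) (hx : x ∈ Q) :
    v (y - x) ≤ bregman Q d z x - bregman Q d y x - bregman Q d z y := by
  have h1 := tendsto_segment_slope hQ hd.differentiable hy.1 hx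
  have h3 := ge_of_tendsto (b := fderivWithin ℝ d Q z (x - y) - v (x - y)) h1 (by
    filter_upwards [eventually_mem_Ioc] with t ht
    have hm : y + t • (x - y) ∈ Q := hQ.add_smul_sub_mem hy.1 hx ⟨ht.1.le, ht.2⟩
    have := hy.2 hm
    simp only [Set.mem_ofPred_eq, bregman] at this
    have e : y + t • (x - y) - z = (y - z) + t • (x - y) := by abel
    rw [e, map_add, map_add, map_smul, map_smul, smul_eq_mul, smul_eq_mul] at this
    rw [le_div_iff₀ ht.1]
    linarith)
  have e1 : x - z = (x - y) + (y - z) := by abel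
  have e2 : y - x = -(x - y) := by abel
  unfold bregman
  rw [e1, map_add, e2, map_neg]
  linarith

lemma IsMirr.apply_sub_le_add_sq (hQ : Convex ℝ Q) (hd : IsProxFunction Q d) {z y x : E}
    {v : StrongDual ℝ E} (hz : z ∈ Q) (hy : IsMirr Q d z v y) (hx : x ∈ Q) :
    v (z - x) ≤ bregman Q d z x - bregman Q d y x + ‖v‖ ^ 2 / 2 := by
  have h1 := hy.apply_sub_le hQ hd hx
  have h2 := half_sq_norm_le_bregman hQ hd hz hy.1
  have h3 : v (z - y) ≤ ‖v‖ * ‖y - z‖ := by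
    rw [norm_sub_rev]
    exact (le_abs_self _).trans (v.le_opNorm _)
  have e : z - x = (y - x) + (z - y) := by abel
  rw [e, map_add]
  nlinarith [sq_nonneg (‖v‖ - ‖y - z‖)]

/-- Telescoping the mirror-step inequality. -/
lemma sum_apply_sub_le_of_isMirr (hQ : Convex ℝ Q) (hd : IsProxFunction Q d) {x : ℕ → E}
    {g : ℕ → StrongDual ℝ E} {y : E} {h : ℝ} (hx : ∀ k, x k ∈ Q) (hy : y ∈ Q)
    (hstep : ∀ k, IsMirr Q d (x k) (h • g k) (x (k + 1))) (N : ℕ) :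
    h * ∑ k ∈ Finset.range N, g k (x k - y) ≤
      bregman Q d (x 0) y + h ^ 2 / 2 * ∑ k ∈ Finset.range N, ‖g k‖ ^ 2 := by
  have key : ∀ n, h * ∑ k ∈ Finset.range n, g k (x k - y) ≤
      bregman Q d (x 0) y - bregman Q d (x n) y
        + h ^ 2 / 2 * ∑ k ∈ Finset.range n, ‖g k‖ ^ 2 := by
    intro n
    induction n with
    | zero => simp
    | succ n ih =>
      have := (hstep n).apply_sub_le_add_sq hQ hd (hx n) hy
      rw [norm_smul, mul_pow, Real.norm_eq_abs, sq_abs] at this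
      simp only [_root_.smul_apply, smul_eq_mul] at this
      rw [Finset.sum_range_succ, Finset.sum_range_succ]
      linarith
  have h1 := key N
  have h2 := half_sq_norm_le_bregman hQ hd (hx N) hy
  have h3 := sq_nonneg ‖y - x N‖
  linarith

/-- The mirror step is unique: its objective is strictly convex. -/
lemma IsMirr.eq_of_le (hd : IsProxFunction Q d) {z y y' : E}
    {v : StrongDual ℝ E} (hy : IsMirr Q d z v y) (hy' : y' ∈ Q)
    (hle : v (y' - z) + bregman Q d z y' ≤ v (y - z) + bregman Q d z y) : y' = y := by
  by_contra hne
  have hQ := hd.strongly_convex.1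
  have hs := hd.strongly_convex.2 hy.1 hy' (by norm_num : (0 : ℝ) ≤ 1 / 2)
    (by norm_num : (0 : ℝ) ≤ 1 / 2) (by norm_num)
  have hm := hy.2 (hQ hy.1 hy' (by norm_num : (0 : ℝ) ≤ 1 / 2)
    (by norm_num : (0 : ℝ) ≤ 1 / 2) (by norm_num))
  have hpos : 0 < ‖y - y'‖ := norm_pos_iff.2 (sub_ne_zero.2 (Ne.symm hne))
  have e : (1 / 2 : ℝ) • y + (1 / 2 : ℝ) • y' - z
      = (1 / 2 : ℝ) • (y - z) + (1 / 2 : ℝ) • (y' - z) := by module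
  simp only [Set.mem_ofPred_eq, bregman, smul_eq_mul, e, map_add, map_smul] at hs hm hle
  nlinarith [sq_nonneg ‖y - y'‖]

end Deterministic

section Subgradient

variable {E : Type*} [NormedAddCommGroup E] [NormedSpace ℝ E] {Q : Set E} {f : E → ℝ}

/-- Jensen's inequality for a function with a subgradient at every point of the set. -/
lemma map_average_le_of_subdifferentialOn {f' : E → StrongDual ℝ E} (hQ : Convex ℝ Q)
    (hf : ∀ x ∈ Q, f' x ∈ subdifferentialOn Q f x) {ι : Type*} {s : Finset ι} (hs : s.Nonempty)
    {x : ι → E} (hx : ∀ i ∈ s, x i ∈ Q) :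
    (1 / (s.card : ℝ)) • ∑ i ∈ s, x i ∈ Q ∧
      f ((1 / (s.card : ℝ)) • ∑ i ∈ s, x i) ≤ (1 / (s.card : ℝ)) * ∑ i ∈ s, f (x i) := by
  have hc : (0 : ℝ) < s.card := by exact_mod_cast hs.card_pos
  have hmem : (1 / (s.card : ℝ)) • ∑ i ∈ s, x i ∈ Q := by
    rw [Finset.smul_sum]
    refine hQ.sum_mem (fun _ _ => by positivity) ?_ hx
    simp [hc.ne']
  refine ⟨hmem, ?_⟩
  set y := (1 / (s.card : ℝ)) • ∑ i ∈ s, x i with hy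
  have h1 : ∑ i ∈ s, (f y + f' y (x i - y)) ≤ ∑ i ∈ s, f (x i) :=
    Finset.sum_le_sum fun i hi => hf y hmem _ (hx i hi)
  have h2 : ∑ i ∈ s, f' y (x i - y) = 0 := by
    rw [← map_sum, Finset.sum_sub_distrib, Finset.sum_const, ← Nat.cast_smul_eq_nsmul ℝ, hy,
      smul_smul, mul_one_div_cancel hc.ne', one_smul, sub_self, map_zero]
  rw [Finset.sum_add_distrib, h2, Finset.sum_const, nsmul_eq_mul, add_zero] at h1
  rw [one_div, inv_mul_eq_div, le_div_iff₀ hc]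
  linarith

/-- A function with a subgradient at every point of the set is a supremum of affine functions. -/
lemma lowerSemicontinuousOn_of_subdifferentialOn {f' : E → StrongDual ℝ E}
    (hf : ∀ x ∈ Q, f' x ∈ subdifferentialOn Q f x) : LowerSemicontinuousOn f Q := by
  intro x hx c hc
  have hcont : ContinuousAt (fun y => f x + f' x (y - x)) x := by fun_prop
  have h1 : ∀ᶠ y in nhds x, c < f x + f' x (y - x) :=
    hcont.eventually (lt_mem_nhds (by simpa using hc))
  filter_upwards [nhdsWithin_le_nhds h1, self_mem_nhdsWithin] with y hy hyQ
  exact hy.trans_le (hf x hx y hyQ)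

end Subgradient

section Regret

variable {E : Type*} [NormedAddCommGroup E] [NormedSpace ℝ E] {Q : Set E} {d f : E → ℝ}

/-- The pathwise regret bound for the step size `h = (R / M) √(2 / N)`, normalised by
`M Rbar / √N`. On the right, `‖g k‖² / M²` comes from the mirror steps and the last summand is the
stochastic error of the subgradients. -/
lemma normalized_gap_le {f' : E → StrongDual ℝ E} {g : ℕ → StrongDual ℝ E} {x : ℕ → E} {y : E}
    {M R Rbar : ℝ} {N : ℕ} (hQ : Convex ℝ Q) (hd : IsProxFunction Q d)
    (hf : ∀ x ∈ Q, f' x ∈ subdifferentialOn Q f x) (hM : 0 < M) (hR : 0 < R) (hRR : R ≤ Rbar)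
    (hN : 0 < N) (hx : ∀ k, x k ∈ Q) (hy : y ∈ Q) (hV : bregman Q d (x 0) y ≤ R ^ 2)
    (hstep : ∀ k, IsMirr Q d (x k) ((R / M * Real.sqrt (2 / N)) • g k) (x (k + 1))) :
    Real.sqrt N / (M * Rbar) *
        (f ((1 / (N : ℝ)) • ∑ k ∈ Finset.range N, x k) - f y) ≤
      1 + ∑ k ∈ Finset.range N, (‖g k‖ ^ 2 / M ^ 2 / N +
        (f' (x k) - g k) (x k - y) / (M * Rbar) / Real.sqrt N) := by
  have hreg := sum_apply_sub_le_of_isMirr hQ hd hx hy hstep N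
  have hN' : (0 : ℝ) < N := by exact_mod_cast hN
  obtain ⟨r, hr0, hrN⟩ : ∃ r : ℝ, 0 < r ∧ (N : ℝ) = r ^ 2 :=
    ⟨Real.sqrt N, Real.sqrt_pos.2 hN', (Real.sq_sqrt hN'.le).symm⟩
  have hjen := (map_average_le_of_subdifferentialOn (f := f) hQ hf
    (Finset.nonempty_range_iff.2 hN.ne') (fun k _ => hx k)).2
  rw [Finset.card_range] at hjen
  set A := ∑ k ∈ Finset.range N, g k (x k - y) with hA
  set B := ∑ k ∈ Finset.range N, ‖g k‖ ^ 2 with hB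
  set D := ∑ k ∈ Finset.range N, (f' (x k) - g k) (x k - y) with hD
  have hsub : ∑ k ∈ Finset.range N, f (x k) ≤ N * f y + (A + D) := by
    have : ∑ k ∈ Finset.range N, f (x k) ≤
        ∑ k ∈ Finset.range N, (f y + (g k (x k - y) + (f' (x k) - g k) (x k - y))) := by
      refine Finset.sum_le_sum fun k _ => ?_
      have h1 := hf (x k) (hx k) y hy
      rw [← neg_sub (x k) y, map_neg] at h1
      rw [_root_.sub_apply]
      linarith
    rwa [Finset.sum_add_distrib, Finset.sum_add_distrib, Finset.sum_const, Finset.card_range,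
      nsmul_eq_mul] at this
  have hRb : 0 < Rbar := hR.trans_le hRR
  -- With `r = √N` and `q = √2` the step size is `(R / M) (q / r)`; only `1 ≤ q ≤ 2` and `q² = 2`
  -- are used.
  have hs : Real.sqrt N = r := by rw [hrN, Real.sqrt_sq hr0.le]
  obtain ⟨q, hq0, hq2, hqe⟩ : ∃ q : ℝ, 1 ≤ q ∧ q ^ 2 = 2 ∧ Real.sqrt (2 / N) = q / r :=
    ⟨Real.sqrt 2, Real.one_le_sqrt.2 (by norm_num), Real.sq_sqrt (by norm_num), by
      rw [Real.sqrt_div (by norm_num), hs]⟩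
  rw [hqe] at hreg
  have hB0 : 0 ≤ B := Finset.sum_nonneg fun _ _ => by positivity
  have hAle : A ≤ R * M * r + R * B / (M * r) := by
    have e1 : R / M * (q / r) * A = (R * q / (M * r)) * A := by field_simp
    have e2 : (R / M * (q / r)) ^ 2 / 2 * B = (R * q / (M * r)) * (q * R * B / (2 * (M * r))) := by
      field_simp
    have e3 : R ^ 2 = (R * q / (M * r)) * (q * R * M * r / 2) := by
      field_simp; linarith
    have h1 : (R * q / (M * r)) * A ≤
        (R * q / (M * r)) * (q * R * M * r / 2 + q * R * B / (2 * (M * r))) := by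
      rw [mul_add, ← e1, ← e2, ← e3]; linarith
    have h2 := le_of_mul_le_mul_left h1 (by positivity)
    have h3 : q / 2 ≤ 1 := by nlinarith
    have e4 : q * R * M * r / 2 + q * R * B / (2 * (M * r))
        = (q / 2) * (R * M * r + R * B / (M * r)) := by field_simp
    rw [e4] at h2
    exact h2.trans (mul_le_of_le_one_left (by positivity) h3)
  have hAle' : A ≤ Rbar * M * r + Rbar * B / (M * r) := by
    refine hAle.trans ?_; gcongr
  have hgap : f ((1 / (N : ℝ)) • ∑ k ∈ Finset.range N, x k) - f y ≤ (A + D) / r ^ 2 := by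
    rw [hrN] at hjen hsub ⊢
    rw [le_div_iff₀ (by positivity)]
    rw [one_div_mul_eq_div, le_div_iff₀ (by positivity)] at hjen
    linarith
  rw [Finset.sum_add_distrib, ← Finset.sum_div, ← Finset.sum_div, ← Finset.sum_div,
    ← Finset.sum_div, hs]
  calc r / (M * Rbar) * (f ((1 / (N : ℝ)) • ∑ k ∈ Finset.range N, x k) - f y)
      ≤ r / (M * Rbar) * ((Rbar * M * r + Rbar * B / (M * r) + D) / r ^ 2) := by
        gcongr
        exact hgap.trans (by gcongr)
    _ = 1 + (B / M ^ 2 / N + D / (M * Rbar) / r) := by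
        rw [hrN]; field_simp; ring

end Regret

/-! ### Measurability and independence of the iterates -/

section Measurability

/-- The unique minimizer over a compact set of a function that is measurable in the parameter and
continuous in the variable depends measurably on the parameter. -/
lemma measurable_of_unique_isMinOn {Ω E : Type*} {mΩ : MeasurableSpace Ω} [MetricSpace E]
    [MeasurableSpace E] [BorelSpace E] {Q : Set E} (hQ : IsCompact Q) {φ : Ω → E → ℝ} {y : Ω → E}
    (hmeas : ∀ x ∈ Q, Measurable fun ω => φ ω x) (hcont : ∀ ω, ContinuousOn (φ ω) Q)
    (hy : ∀ ω, y ω ∈ Q) (hmin : ∀ ω, ∀ x ∈ Q, φ ω (y ω) ≤ φ ω x)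
    (huniq : ∀ ω, ∀ x ∈ Q, φ ω x ≤ φ ω (y ω) → x = y ω) : Measurable y := by
  refine measurable_of_isClosed fun A hA => ?_
  have hAQ : IsCompact (A ∩ Q) := hQ.inter_left hA
  obtain ⟨S, hSQ, hSc, hSd⟩ := hQ.isSeparable.exists_countable_dense_subset
  obtain ⟨T, hTA, hTc, hTd⟩ := hAQ.isSeparable.exists_countable_dense_subset
  -- The minimizer lies in `A` if and only if the infima of `φ ω` over dense subsets of `A ∩ Q`
  -- and of `Q` agree.
  have key : y ⁻¹' A = ⋂ q ∈ S, ⋂ n : ℕ, ⋃ p ∈ T, {ω | φ ω p < φ ω q + 1 / (n + 1 : ℝ)} := by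
    ext ω
    simp only [Set.mem_preimage, Set.mem_iInter, Set.mem_iUnion, Set.mem_ofPred_eq, exists_prop]
    constructor
    · intro hyA q hq n
      have hmem : y ω ∈ closure T := hTd ⟨hyA, hy ω⟩
      have : (nhdsWithin (y ω) T).NeBot := mem_closure_iff_nhdsWithin_neBot.1 hmem
      have hc : Filter.Tendsto (φ ω) (nhdsWithin (y ω) T) (nhds (φ ω (y ω))) :=
        (hcont ω (y ω) (hy ω)).mono_left (nhdsWithin_mono _ fun p hp => (hTA hp).2)
      have hlt : φ ω (y ω) < φ ω q + 1 / (n + 1 : ℝ) :=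
        lt_of_le_of_lt (hmin ω q (hSQ hq)) (by linarith [Nat.one_div_pos_of_nat (α := ℝ) (n := n)])
      obtain ⟨p, hp, hpT⟩ := ((hc.eventually (gt_mem_nhds hlt)).and self_mem_nhdsWithin).exists
      exact ⟨p, hpT, hp⟩
    · intro h
      have hmem : y ω ∈ closure S := hSd (hy ω)
      have hne : (nhdsWithin (y ω) S).NeBot := mem_closure_iff_nhdsWithin_neBot.1 hmem
      obtain ⟨q₀, hq₀⟩ : S.Nonempty := closure_nonempty_iff.1 ⟨_, hmem⟩
      obtain ⟨p₁, hp₁, -⟩ := h q₀ hq₀ 0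
      obtain ⟨p, hpm, hp⟩ := hAQ.exists_isMinOn ⟨p₁, hTA hp₁⟩
        ((hcont ω).mono Set.inter_subset_right)
      have hle : ∀ q ∈ S, φ ω p ≤ φ ω q := by
        intro q hq
        refine le_of_forall_pos_lt_add fun e he => ?_
        obtain ⟨n, hn⟩ := exists_nat_one_div_lt he
        obtain ⟨p', hp', hlt⟩ := h q hq n
        have : φ ω p ≤ φ ω p' := hp (hTA hp')
        linarith
      have hc : Filter.Tendsto (φ ω) (nhdsWithin (y ω) S) (nhds (φ ω (y ω))) :=
        (hcont ω (y ω) (hy ω)).mono_left (nhdsWithin_mono _ hSQ)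
      have hle' : φ ω p ≤ φ ω (y ω) := ge_of_tendsto hc (by
        filter_upwards [self_mem_nhdsWithin] with q hq using hle q hq)
      rw [← huniq ω p hpm.2 hle']
      exact hpm.1
  rw [key]
  refine MeasurableSet.biInter hSc fun q hq => MeasurableSet.iInter fun n =>
    MeasurableSet.biUnion hTc fun p hp => ?_
  exact measurableSet_lt (hmeas p (hTA hp).2) ((hmeas q (hSQ hq)).add_const _)

lemma measurable_comp_of_continuousOn {Ω E : Type*} {mΩ : MeasurableSpace Ω} [TopologicalSpace E]
    [MeasurableSpace E] [BorelSpace E] {Q : Set E} {d : E → ℝ} (hd : ContinuousOn d Q)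
    {x : Ω → E} (hx : Measurable x) (hxQ : ∀ ω, x ω ∈ Q) : Measurable fun ω => d (x ω) :=
  (continuousOn_iff_continuous_domRestrict.1 hd).measurable.comp (hx.subtype_mk (h := hxQ))

variable {E : Type*} [NormedAddCommGroup E] [NormedSpace ℝ E] [FiniteDimensional ℝ E]
  [MeasurableSpace E] [BorelSpace E]

lemma measurable_dual_apply {Ω : Type*} {mΩ : MeasurableSpace Ω} {g : Ω → StrongDual ℝ E} {x : Ω → E}
    (hg : Measurable g) (hx : Measurable x) : Measurable fun ω => g ω (x ω) := by
  have hc : Continuous fun p : StrongDual ℝ E × E => p.1 p.2 := by fun_prop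
  have : ProperSpace E := FiniteDimensional.proper_real E
  exact hc.measurable.comp (hg.prodMk hx)

/-- Although `fderivWithin` involves a choice when `Q` has empty interior, the Bregman divergence
depends measurably on its base point, being a limit of difference quotients of `d` on `Q`. -/
lemma measurable_bregman {Ω : Type*} {mΩ : MeasurableSpace Ω} {Q : Set E} {d : E → ℝ}
    (hQ : Convex ℝ Q) (hd : DifferentiableOn ℝ d Q) {z : Ω → E} (hz : Measurable z)
    (hzQ : ∀ ω, z ω ∈ Q) {x : E} (hx : x ∈ Q) :
    Measurable fun ω => bregman Q d (z ω) x := by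
  have : ProperSpace E := FiniteDimensional.proper_real E
  have hdz := measurable_comp_of_continuousOn hd.continuousOn hz hzQ
  refine (hdz.const_sub (d x)).sub ?_
  have ht : Filter.Tendsto (fun n : ℕ => 1 / ((n : ℝ) + 1)) Filter.atTop
      (nhdsWithin 0 (Set.Ioi 0)) :=
    tendsto_nhdsWithin_iff.2 ⟨tendsto_one_div_add_atTop_nhds_zero_nat,
      Filter.Eventually.of_forall fun n => Set.mem_Ioi.2 Nat.one_div_pos_of_nat⟩
  refine measurable_of_tendsto_metrizable (f := fun (n : ℕ) ω =>
    (d (z ω + (1 / ((n : ℝ) + 1)) • (x - z ω)) - d (z ω)) / (1 / ((n : ℝ) + 1)))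
    (fun n => ?_) (tendsto_pi_nhds.2 fun ω => ?_)
  · refine Measurable.div_const (Measurable.sub ?_ hdz) _
    refine measurable_comp_of_continuousOn hd.continuousOn
      (hz.add ((hz.const_sub x).const_smul _)) fun ω => ?_
    refine hQ.add_smul_sub_mem (hzQ ω) hx ⟨Nat.one_div_pos_of_nat.le, ?_⟩
    rw [div_le_one (by positivity)]
    linarith [Nat.cast_nonneg (α := ℝ) n]
  · exact (tendsto_segment_slope hQ hd (hzQ ω) hx).comp ht

end Measurability

section PastSample

variable {Ξ : Type v} {Ω : Type w} [MeasurableSpace Ξ]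

/-- The σ-algebra generated by the sample before time `k`. -/
@[reducible]
def pastSample (ξ : ℕ → Ω → Ξ) (k : ℕ) : MeasurableSpace Ω :=
  ⨆ j ∈ Set.Iio k, MeasurableSpace.comap (ξ j) inferInstance

lemma pastSample_mono (ξ : ℕ → Ω → Ξ) : Monotone (pastSample ξ) :=
  fun _ _ hkl => biSup_mono fun _ hj => lt_of_lt_of_le hj hkl

lemma measurable_pastSample_succ (ξ : ℕ → Ω → Ξ) (k : ℕ) :
    Measurable[pastSample ξ (k + 1)] (ξ k) :=
  measurable_iff_comap_le.2 (le_biSup (fun j => MeasurableSpace.comap (ξ j) inferInstance)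
    (Set.mem_Iio.2 k.lt_succ_self))

end PastSample

section Run

variable {E : Type u} {Ξ : Type v} {Ω : Type w} [NormedAddCommGroup E] [NormedSpace ℝ E]
  [MeasurableSpace E] [mΞ : MeasurableSpace Ξ]
  [mΩ : MeasurableSpace Ω] {μ : Measure Ω} {Q : Set E} {P : Measure Ξ} {d : E → ℝ}
  {G : E → Ξ → StrongDual ℝ E} {h : ℝ} {x₀ : E} {ξ : ℕ → Ω → Ξ} {x : ℕ → Ω → E}

lemma pastSample_le (hξ : ∀ k, Measurable (ξ k)) (k : ℕ) : pastSample ξ k ≤ mΩ :=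
  iSup₂_le fun j _ => measurable_iff_comap_le.1 (hξ j)

lemma indep_pastSample (hξ : ∀ k, Measurable (ξ k)) (hind : iIndepFun ξ μ) (k : ℕ) :
    Indep (pastSample ξ k) (MeasurableSpace.comap (ξ k) mΞ) μ := by
  have := indep_iSup_of_disjoint (fun j => measurable_iff_comap_le.1 (hξ j)) hind
    (S := Set.Iio k) (T := {k}) (by simp)
  simpa [pastSample] using this

lemma IsSMDRun.mem (hrun : IsSMDRun μ Q P d G h x₀ ξ x) (hx₀ : x₀ ∈ Q) (k : ℕ) (ω : Ω) :
    x k ω ∈ Q := by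
  cases k with
  | zero => rw [hrun.start]; exact hx₀
  | succ k => exact (hrun.step k ω).1

/-- The iterate `x^k` is a measurable function of the sample before time `k`. -/
lemma IsSMDRun.measurable_pastSample [FiniteDimensional ℝ E] [BorelSpace E]
    (hrun : IsSMDRun μ Q P d G h x₀ ξ x) (hQ : Convex ℝ Q) (hQc : IsCompact Q)
    (hd : IsProxFunction Q d) (hG : Measurable (fun p : E × Ξ => G p.1 p.2)) (hx₀ : x₀ ∈ Q)
    (k : ℕ) : Measurable[pastSample ξ k] (x k) := by
  induction k with
  | zero =>
    have : x 0 = fun _ => x₀ := funext hrun.start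
    rw [this]
    exact measurable_const
  | succ k ih =>
    have : ProperSpace E := FiniteDimensional.proper_real E
    have hxk : Measurable[pastSample ξ (k + 1)] (x k) :=
      ih.mono (pastSample_mono ξ k.le_succ) le_rfl
    have hξk := measurable_pastSample_succ ξ k
    refine measurable_of_unique_isMinOn hQc
      (φ := fun ω y => (h • G (x k ω) (ξ k ω)) (y - x k ω) + bregman Q d (x k ω) y) ?_ ?_
      (fun ω => (hrun.step k ω).1) (fun ω y hy => (hrun.step k ω).2 hy)
      (fun ω y hy hle => (hrun.step k ω).eq_of_le hd hy hle)
    · intro y hy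
      refine Measurable.add (measurable_dual_apply ?_ (hxk.const_sub y))
        (measurable_bregman hQ hd.differentiable hxk (hrun.mem hx₀ k) hy)
      exact (hG.comp (hxk.prodMk hξk)).const_smul h
    · intro ω
      have := hd.differentiable.continuousOn
      unfold bregman
      fun_prop

/-- Conditioning on a random element independent of `ξ`. -/
lemma lintegral_comp_prodMk_of_indepFun {α : Type*} [MeasurableSpace α] [IsProbabilityMeasure μ]
    {X : Ω → α} {Y : Ω → Ξ} (hX : Measurable X) (hY : Measurable Y) (hXY : IndepFun X Y μ)
    (hlaw : μ.map Y = P) {Φ : α × Ξ → ℝ≥0∞} (hΦ : Measurable Φ) :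
    ∫⁻ ω, Φ (X ω, Y ω) ∂μ = ∫⁻ ω, ∫⁻ s, Φ (X ω, s) ∂P ∂μ := by
  have : IsProbabilityMeasure P := hlaw ▸ Measure.isProbabilityMeasure_map hY.aemeasurable
  have h1 := (indepFun_iff_map_prod_eq_prod_map_map hX.aemeasurable hY.aemeasurable).1 hXY
  rw [← lintegral_map (μ := μ) hΦ (hX.prodMk hY), h1, hlaw, lintegral_prod _ hΦ.aemeasurable,
    lintegral_map hΦ.lintegral_prod_right' hX]

lemma lintegral_comp_prodMk_of_measurable_pastSample {α : Type*} [MeasurableSpace α]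
    [IsProbabilityMeasure μ] (hrun : IsSMDRun μ Q P d G h x₀ ξ x) {k : ℕ} {X : Ω → α}
    (hX : Measurable[pastSample ξ k] X) {Φ : α × Ξ → ℝ≥0∞} (hΦ : Measurable Φ) :
    ∫⁻ ω, Φ (X ω, ξ k ω) ∂μ = ∫⁻ ω, ∫⁻ s, Φ (X ω, s) ∂P ∂μ := by
  refine lintegral_comp_prodMk_of_indepFun (hX.mono (pastSample_le hrun.measurable_sample k) le_rfl)
    (hrun.measurable_sample k) ?_ (hrun.law_sample k) hΦ
  rw [IndepFun_iff_Indep]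
  exact indep_of_indep_of_le_left (indep_pastSample hrun.measurable_sample hrun.indep_sample k)
    (measurable_iff_comap_le.1 hX)

variable [FiniteDimensional ℝ E] [BorelSpace E] [IsProbabilityMeasure μ]

/-- One conditional bound for every feasible point bounds the expectation of the product of the
weights along the run. -/
lemma IsSMDRun.lintegral_prod_le (hrun : IsSMDRun μ Q P d G h x₀ ξ x) (hQ : Convex ℝ Q)
    (hQc : IsCompact Q) (hd : IsProxFunction Q d) (hG : Measurable (fun p : E × Ξ => G p.1 p.2))
    (hx₀ : x₀ ∈ Q) {w : E × Ξ → ℝ≥0∞} (hw : Measurable w) {b : ℝ≥0∞}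
    (hb : ∀ z ∈ Q, ∫⁻ s, w (z, s) ∂P ≤ b) (n : ℕ) :
    ∫⁻ ω, ∏ k ∈ Finset.range n, w (x k ω, ξ k ω) ∂μ ≤ b ^ n := by
  induction n with
  | zero => simp
  | succ n ih =>
    have hxm := hrun.measurable_pastSample hQ hQc hd hG hx₀
    have hW : Measurable[pastSample ξ n] fun ω => ∏ k ∈ Finset.range n, w (x k ω, ξ k ω) := by
      refine Finset.measurable_fun_prod _ fun k hk => ?_
      have hk' := Finset.mem_range.1 hk
      refine hw.comp (Measurable.prodMk ?_ ?_)
      · exact (hxm k).mono (pastSample_mono ξ hk'.le) le_rfl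
      · exact (measurable_pastSample_succ ξ k).mono (pastSample_mono ξ hk') le_rfl
    have hX := hW.prodMk (hxm n)
    have hΦ : Measurable fun p : (ℝ≥0∞ × E) × Ξ => p.1.1 * w (p.1.2, p.2) := by fun_prop
    have h1 := lintegral_comp_prodMk_of_measurable_pastSample hrun hX hΦ
    simp only at h1
    simp_rw [Finset.prod_range_succ]
    rw [h1, pow_succ]
    calc ∫⁻ ω, ∫⁻ s, (∏ k ∈ Finset.range n, w (x k ω, ξ k ω)) * w (x n ω, s) ∂P ∂μ
        ≤ ∫⁻ ω, (∏ k ∈ Finset.range n, w (x k ω, ξ k ω)) * b ∂μ := by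
          refine lintegral_mono fun ω => ?_
          rw [lintegral_const_mul _ (by fun_prop)]
          gcongr
          exact hb _ (hrun.mem hx₀ n ω)
      _ = (∫⁻ ω, ∏ k ∈ Finset.range n, w (x k ω, ξ k ω) ∂μ) * b :=
          lintegral_mul_const _ (hW.mono (pastSample_le hrun.measurable_sample n) le_rfl)
      _ ≤ b ^ n * b := by gcongr

lemma IsSMDRun.measure_exists_le (hrun : IsSMDRun μ Q P d G h x₀ ξ x) (hQ : Convex ℝ Q)
    (hQc : IsCompact Q) (hd : IsProxFunction Q d) (hG : Measurable (fun p : E × Ξ => G p.1 p.2))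
    (hx₀ : x₀ ∈ Q) {A : Set (E × Ξ)} (hA : MeasurableSet A) {δ : ℝ≥0∞}
    (hδ : ∀ z ∈ Q, P {s | (z, s) ∈ A} ≤ δ) (n : ℕ) :
    μ {ω | ∃ k < n, (x k ω, ξ k ω) ∈ A} ≤ n * δ := by
  have hstep : ∀ k, μ {ω | (x k ω, ξ k ω) ∈ A} ≤ δ := by
    intro k
    have hxm := hrun.measurable_pastSample hQ hQc hd hG hx₀ k
    have hΦ : Measurable (A.indicator (1 : E × Ξ → ℝ≥0∞)) := measurable_one.indicator hA
    have h1 := lintegral_comp_prodMk_of_measurable_pastSample hrun hxm hΦ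
    have hmA : MeasurableSet {ω | (x k ω, ξ k ω) ∈ A} :=
      ((hrun.measurable_iterate k).prodMk (hrun.measurable_sample k)) hA
    have h2 : μ {ω | (x k ω, ξ k ω) ∈ A} = ∫⁻ ω, A.indicator 1 (x k ω, ξ k ω) ∂μ :=
      (lintegral_indicator_one hmA).symm
    rw [h2, h1]
    calc ∫⁻ ω, ∫⁻ s, A.indicator 1 (x k ω, s) ∂P ∂μ ≤ ∫⁻ _, δ ∂μ := by
          refine lintegral_mono fun ω => ?_
          have hmS : MeasurableSet {s | (x k ω, s) ∈ A} := measurable_prodMk_left hA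
          exact (lintegral_indicator_one hmS).trans_le (hδ _ (hrun.mem hx₀ k ω))
      _ = δ := by simp
  have hset : {ω | ∃ k < n, (x k ω, ξ k ω) ∈ A}
      = ⋃ k ∈ Finset.range n, {ω | (x k ω, ξ k ω) ∈ A} := by
    ext ω; simp
  rw [hset]
  refine (measure_biUnion_finset_le _ _).trans ?_
  exact (Finset.sum_le_sum fun k _ => hstep k).trans (by simp)

end Run

/-! ### Averaging independent outputs -/

section Averaging

/-- A truncated Chernoff bound for independent nonnegative variables `Y i` which have an exponential
moment only outside the rare events `(B i)ᶜ`. -/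
lemma measure_sum_ge_le {Ω : Type*} [MeasurableSpace Ω] {μ : Measure Ω} [IsProbabilityMeasure μ]
    {K : ℕ} {σ : ℝ} (hK : 0 < K) (hσ : 0 < σ) (hσK : Real.exp (-(K / 2)) ≤ σ)
    (hKσ : Real.exp (K / 2) * σ ≤ Real.exp 1) {Y : Fin K → Ω → ℝ} {B : Fin K → Set Ω}
    (hY : ∀ i, Measurable (Y i)) (hY0 : ∀ i ω, 0 ≤ Y i ω) (hind : iIndepFun Y μ)
    (hB : ∀ i, MeasurableSet (B i)) (hBc : ∀ i, μ (B i)ᶜ ≤ ENNReal.ofReal (σ / (4 * K)))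
    (hexp : ∀ i, ∫⁻ ω in B i, ENNReal.ofReal (Real.exp (Y i ω / 16)) ∂μ
      ≤ ENNReal.ofReal (Real.exp 7)) :
    μ {ω | 3520 * (K : ℝ) ≤ ∑ i, Y i ω} ≤ ENNReal.ofReal σ := by
  have hK1 : (1 : ℝ) ≤ K := by exact_mod_cast hK
  have hK0 : (0 : ℝ) < K := by linarith
  -- A single `Y i` exceeds the truncation level `176 K` with probability much smaller than `σ / K`.
  have htail : ∀ i, μ {ω | 176 * (K : ℝ) < Y i ω} ≤
      ENNReal.ofReal (σ / (4 * K) + Real.exp (7 - 11 * K)) := by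
    intro i
    have hmem : μ.restrict (B i) {ω | ENNReal.ofReal (Real.exp (11 * K)) ≤
        ENNReal.ofReal (Real.exp (Y i ω / 16))} ≤ ENNReal.ofReal (Real.exp (7 - 11 * K)) := by
      refine (meas_ge_le_lintegral_div (by have := hY i; fun_prop)
        (by simp [Real.exp_pos]) (by simp)).trans ?_
      rw [Real.exp_sub, ENNReal.ofReal_div_of_pos (Real.exp_pos _)]
      gcongr
      exact hexp i
    rw [ENNReal.ofReal_add (by positivity) (by positivity)]
    refine le_trans ?_ (add_le_add (hBc i) hmem)
    rw [Measure.restrict_apply' (hB i)]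
    refine (measure_mono ?_).trans (measure_union_le _ _)
    intro ω hω
    by_cases hb : ω ∈ B i
    · refine Or.inr ⟨ENNReal.ofReal_le_ofReal (Real.exp_le_exp.2 ?_), hb⟩
      have : 176 * (K : ℝ) < Y i ω := hω
      linarith
    · exact Or.inl hb
  -- The truncated variables have a bounded exponential moment.
  have hmom : ∀ i, ∫⁻ ω, ENNReal.ofReal (Real.exp (min (Y i ω) (176 * K) / 352)) ∂μ ≤
      ENNReal.ofReal (Real.exp 8) := by
    intro i
    rw [← lintegral_add_compl _ (hB i)]
    have h1 : ∫⁻ ω in B i, ENNReal.ofReal (Real.exp (min (Y i ω) (176 * K) / 352)) ∂μ ≤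
        ENNReal.ofReal (Real.exp 7) := by
      refine le_trans (lintegral_mono fun ω => ?_) (hexp i)
      refine ENNReal.ofReal_le_ofReal (Real.exp_le_exp.2 ?_)
      have := min_le_left (Y i ω) (176 * K)
      linarith [hY0 i ω]
    have h2 : ∫⁻ ω in (B i)ᶜ, ENNReal.ofReal (Real.exp (min (Y i ω) (176 * K) / 352)) ∂μ ≤
        ENNReal.ofReal (Real.exp (K / 2)) * ENNReal.ofReal (σ / (4 * K)) := by
      refine le_trans (lintegral_mono (g := fun _ => ENNReal.ofReal (Real.exp (K / 2)))
        fun ω => ?_) ?_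
      · refine ENNReal.ofReal_le_ofReal (Real.exp_le_exp.2 ?_)
        have := min_le_right (Y i ω) (176 * K)
        linarith
      · rw [setLIntegral_const]
        gcongr
        exact hBc i
    refine (add_le_add h1 h2).trans ?_
    rw [← ENNReal.ofReal_mul (by positivity), ← ENNReal.ofReal_add (by positivity) (by positivity)]
    refine ENNReal.ofReal_le_ofReal ?_
    have h3 : Real.exp (K / 2) * (σ / (4 * K)) ≤ Real.exp 1 := by
      rw [← mul_div_assoc, div_le_iff₀ (by positivity)]
      nlinarith [Real.exp_pos 1]
    have h4 : Real.exp 1 ≤ Real.exp 7 := Real.exp_le_exp.2 (by norm_num)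
    have h5 : Real.exp 8 = Real.exp 7 * Real.exp 1 := by rw [← Real.exp_add]; norm_num
    nlinarith [Real.add_one_le_exp (1 : ℝ), Real.exp_pos 7]
  -- The exponential Chebyshev inequality with parameter `1 / 352`, which is small enough for
  -- `exp (min (Y i) (176 K) / 352) ≤ exp (K / 2)`, of order `1 / σ`; and `3520 = 10 * 352`.
  have hsum : μ {ω | 3520 * (K : ℝ) ≤ ∑ i, min (Y i ω) (176 * K)} ≤
      ENNReal.ofReal (Real.exp (-(2 * K))) := by
    have hind' : iIndepFun
        (fun i ω => ENNReal.ofReal (Real.exp (min (Y i ω) (176 * K) / 352))) μ :=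
      hind.comp (fun _ t => ENNReal.ofReal (Real.exp (min t (176 * K) / 352)))
        (fun _ => by fun_prop)
    have hprod := lintegral_prod_eq_prod_lintegral_of_indepFun Finset.univ _ hind'
      (fun i => by have := hY i; fun_prop)
    have hset : {ω | 3520 * (K : ℝ) ≤ ∑ i, min (Y i ω) (176 * K)} ⊆
        {ω | ENNReal.ofReal (Real.exp (10 * K)) ≤
          ∏ i, ENNReal.ofReal (Real.exp (min (Y i ω) (176 * K) / 352))} := by
      intro ω hω
      have hω' : 3520 * (K : ℝ) ≤ ∑ i, min (Y i ω) (176 * K) := hω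
      rw [Set.mem_ofPred_eq, ← ENNReal.ofReal_prod_of_nonneg (fun _ _ => (Real.exp_pos _).le),
        ← Real.exp_sum, ← Finset.sum_div]
      refine ENNReal.ofReal_le_ofReal (Real.exp_le_exp.2 ?_)
      linarith
    refine (measure_mono hset).trans ((meas_ge_le_lintegral_div (Measurable.aemeasurable ?_)
      (by simp [Real.exp_pos]) (by simp)).trans ?_)
    · exact Finset.measurable_fun_prod _ fun i _ => by have := hY i; fun_prop
    · rw [hprod]
      refine (ENNReal.div_le_div_right (Finset.prod_le_pow_card _ _ _ fun i _ => hmom i) _).trans ?_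
      rw [Finset.card_univ, Fintype.card_fin, ← ENNReal.ofReal_pow (Real.exp_pos _).le,
        ← Real.exp_nat_mul, ← ENNReal.ofReal_div_of_pos (Real.exp_pos _), ← Real.exp_sub]
      refine ENNReal.ofReal_le_ofReal (Real.exp_le_exp.2 ?_)
      linarith
  have hcover : {ω | 3520 * (K : ℝ) ≤ ∑ i, Y i ω} ⊆
      {ω | 3520 * (K : ℝ) ≤ ∑ i, min (Y i ω) (176 * K)} ∪ ⋃ i, {ω | 176 * (K : ℝ) < Y i ω} := by
    intro ω hω
    by_cases hlarge : ∃ i, 176 * (K : ℝ) < Y i ω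
    · exact Or.inr (Set.mem_iUnion.2 hlarge)
    · push Not at hlarge
      left
      have : ∀ i, min (Y i ω) (176 * K) = Y i ω := fun i => min_eq_left (hlarge i)
      simpa [this] using hω
  refine (measure_mono hcover).trans ((measure_union_le _ _).trans ?_)
  refine (add_le_add hsum ((measure_iUnion_fintype_le _ _).trans
    (Finset.sum_le_sum fun i _ => htail i))).trans ?_
  rw [Finset.sum_const, Finset.card_univ, Fintype.card_fin, nsmul_eq_mul, ← ENNReal.ofReal_natCast,
    ← ENNReal.ofReal_mul hK0.le, ← ENNReal.ofReal_add (by positivity) (by positivity)]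
  refine ENNReal.ofReal_le_ofReal ?_
  have h1 : (K : ℝ) * (σ / (4 * K)) = σ / 4 := by field_simp
  have h2 : (K : ℝ) * Real.exp (7 - 11 * K) ≤ Real.exp (-(2 * K)) := by
    have h3 : (K : ℝ) ≤ Real.exp K := by linarith [Real.add_one_le_exp (K : ℝ)]
    calc (K : ℝ) * Real.exp (7 - 11 * K) ≤ Real.exp K * Real.exp (7 - 11 * K) := by gcongr
      _ = Real.exp (7 - 10 * K) := by rw [← Real.exp_add]; ring_nf
      _ ≤ _ := Real.exp_le_exp.2 (by linarith)
  have h4 : 2 * Real.exp (-(2 * K)) ≤ σ * (3 / 4) := by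
    have e : Real.exp (-(K / 2)) = Real.exp (-(2 * K)) * Real.exp (3 / 2 * K) := by
      rw [← Real.exp_add]; ring_nf
    have h5 : 8 / 3 ≤ Real.exp (3 / 2 * K) := by
      have h6 := Real.quadratic_le_exp_of_nonneg (x := 3 / 2 * (K : ℝ)) (by positivity)
      nlinarith
    have := Real.exp_pos (-(2 * (K : ℝ)))
    nlinarith
  rw [mul_add, h1]
  linarith

end Averaging

/-! ### The exponential moment of a truncated step -/

section Step

lemma step_majorant_nonneg {N s D : ℝ} (hN : 1 ≤ N) (hs : 0 ≤ s)
    (hD : |D| ≤ 3 / 2 * (1 + Real.sqrt s)) :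
    0 ≤ 1 + D / (16 * Real.sqrt N) + (s + 1) / N := by
  obtain ⟨q, hq, hq0, rfl⟩ : ∃ q, Real.sqrt s = q ∧ 0 ≤ q ∧ s = q ^ 2 :=
    ⟨_, rfl, Real.sqrt_nonneg s, (Real.sq_sqrt hs).symm⟩
  obtain ⟨r, hr, hr1, rfl⟩ : ∃ r, Real.sqrt N = r ∧ 1 ≤ r ∧ N = r ^ 2 :=
    ⟨_, rfl, Real.one_le_sqrt.2 hN, (Real.sq_sqrt (by linarith)).symm⟩
  rw [hq] at hD
  rw [hr]
  have e : 1 + D / (16 * r) + (q ^ 2 + 1) / r ^ 2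
      = (16 * r ^ 2 + D * r + 16 * (q ^ 2 + 1)) / (16 * r ^ 2) := by field_simp
  rw [e]
  refine div_nonneg ?_ (by positivity)
  have := (abs_le.1 hD).1
  nlinarith [sq_nonneg (r - q), mul_nonneg hq0 (by linarith : (0 : ℝ) ≤ r)]

/-- For a step with normalised squared subgradient norm `s` and noise `D`, the exponential is
expanded to second order when `s ≤ N`. The noise lost by truncation at `N` is absorbed by a multiple
of `s / N`; for larger `s` the term `s / N` dominates. -/
lemma exp_step_le {N s D : ℝ} (hN : 1 ≤ N) (hs : 0 ≤ s) (hD : |D| ≤ 3 / 2 * (1 + Real.sqrt s)) :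
    Real.exp ((s / N + D / Real.sqrt N) / 16) ≤
      if N < s then Real.exp (s / (4 * N)) else 1 + D / (16 * Real.sqrt N) + (s + 1) / N := by
  obtain ⟨q, hq, hq0, rfl⟩ : ∃ q, Real.sqrt s = q ∧ 0 ≤ q ∧ s = q ^ 2 :=
    ⟨_, rfl, Real.sqrt_nonneg s, (Real.sq_sqrt hs).symm⟩
  obtain ⟨r, hr, hr1, rfl⟩ : ∃ r, Real.sqrt N = r ∧ 1 ≤ r ∧ N = r ^ 2 :=
    ⟨_, rfl, Real.one_le_sqrt.2 hN, (Real.sq_sqrt (by linarith)).symm⟩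
  rw [hq] at hD
  rw [hr]
  have hr0 : 0 < r := by linarith
  have hD' := abs_le.1 hD
  split_ifs with h
  · have hqr : r < q := lt_of_pow_lt_pow_left₀ 2 hq0 h
    refine Real.exp_le_exp.2 ?_
    rw [div_add_div _ _ (by positivity) hr0.ne', div_div, div_le_div_iff₀ (by positivity)
      (by positivity)]
    have h1 : D * r ≤ 3 * q ^ 2 := by nlinarith
    have h2 : r ^ 2 * D ≤ 3 * q ^ 2 * r := by nlinarith
    nlinarith [mul_nonneg (sub_nonneg.2 h2) (by positivity : (0 : ℝ) ≤ 4 * r ^ 2)]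
  · have hqr : q ≤ r := le_of_pow_le_pow_left₀ two_ne_zero hr0.le (not_lt.1 h)
    set v := (q ^ 2 / r ^ 2 + D / r) / 16 with hv
    have hvabs : |v| ≤ (3 / 2 + 5 / 2 * q) / (16 * r) := by
      have h1 : q ^ 2 / r ^ 2 ≤ q / r := by
        rw [div_le_div_iff₀ (by positivity) hr0]; nlinarith [mul_nonneg hq0 hr0.le]
      have h2 : |D / r| ≤ 3 / 2 * (1 + q) / r := by
        rw [abs_div, abs_of_pos hr0]; gcongr
      have h3 : 0 ≤ q ^ 2 / r ^ 2 := by positivity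
      have e : (3 / 2 + 5 / 2 * q) / (16 * r) = (q / r + 3 / 2 * (1 + q) / r) / 16 := by
        field_simp; ring
      rw [e, hv, abs_div, abs_of_pos (by norm_num : (0 : ℝ) < 16)]
      gcongr
      refine (abs_add_le _ _).trans ?_
      rw [abs_of_nonneg h3]
      linarith
    have hv1 : |v| ≤ 1 := by
      refine hvabs.trans ?_
      rw [div_le_one (by positivity)]
      linarith
    have hv2 : v ^ 2 ≤ (q ^ 2 + 1) / (16 * r ^ 2) := by
      rw [← sq_abs]
      refine (pow_le_pow_left₀ (abs_nonneg v) hvabs 2).trans ?_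
      rw [div_pow, div_le_div_iff₀ (by positivity) (by positivity)]
      nlinarith [sq_nonneg (q - 1), sq_nonneg r, mul_nonneg (sq_nonneg r) (sq_nonneg (q - 1)),
        mul_nonneg (sq_nonneg r) (sq_nonneg q)]
    have h1 := (abs_le.1 (Real.abs_exp_sub_one_sub_id_le hv1)).2
    have e : v = D / (16 * r) + q ^ 2 / (16 * r ^ 2) := by rw [hv]; field_simp; ring
    have h2 : q ^ 2 / (16 * r ^ 2) + (q ^ 2 + 1) / (16 * r ^ 2) ≤ (q ^ 2 + 1) / r ^ 2 := by
      rw [← add_div, div_le_div_iff₀ (by positivity) (by positivity)]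
      nlinarith [mul_nonneg (sq_nonneg r) (sq_nonneg q), sq_nonneg r]
    linarith

/-- The exponential moment of one step, truncated at `s ≤ τ`, is `1 + O(1 / N)`: the first-order
noise term has mean zero. -/
lemma lintegral_exp_step_le {Ξ : Type*} [MeasurableSpace Ξ] {P : Measure Ξ}
    [IsProbabilityMeasure P] {N τ : ℝ} {s D : Ξ → ℝ} (hN : 1 ≤ N) (hs0 : ∀ t, 0 ≤ s t)
    (hsm : Measurable s) (hsi : Integrable s P) (hs1 : ∫ t, s t ∂P ≤ 1) (hDi : Integrable D P)
    (hD0 : ∫ t, D t ∂P = 0) (hD : ∀ t, |D t| ≤ 3 / 2 * (1 + Real.sqrt (s t)))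
    (htail : ∫⁻ t in {t | N < s t ∧ s t ≤ τ}, ENNReal.ofReal (Real.exp (s t / (4 * N))) ∂P
      ≤ ENNReal.ofReal (4 / N)) :
    ∫⁻ t, {t | s t ≤ τ}.indicator
        (fun t => ENNReal.ofReal (Real.exp ((s t / N + D t / Real.sqrt N) / 16))) t ∂P
      ≤ ENNReal.ofReal (Real.exp (6 / N)) := by
  have hN0 : 0 < N := by linarith
  have h1 : Integrable (fun t => 1 + D t / (16 * Real.sqrt N)) P :=
    (integrable_const _).add (hDi.div_const _)
  have h2 : Integrable (fun t => s t + 1) P := hsi.add (integrable_const _)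
  have hmaj : Integrable (fun t => 1 + D t / (16 * Real.sqrt N) + (s t + 1) / N) P :=
    h1.add (h2.div_const _)
  have hint : ∫ t, (1 + D t / (16 * Real.sqrt N) + (s t + 1) / N) ∂P ≤ 1 + 2 / N := by
    rw [integral_add h1 (h2.div_const _), integral_add (integrable_const _) (hDi.div_const _),
      integral_div, integral_div, integral_add hsi (integrable_const _), hD0]
    simp only [integral_const, probReal_univ, smul_eq_mul, mul_one, zero_div, add_zero]
    gcongr
    linarith
  have hms : MeasurableSet {t | N < s t ∧ s t ≤ τ} :=
    (measurableSet_lt measurable_const hsm).inter (measurableSet_le hsm measurable_const)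
  calc _ ≤ ∫⁻ t, (ENNReal.ofReal (1 + D t / (16 * Real.sqrt N) + (s t + 1) / N) +
        {t | N < s t ∧ s t ≤ τ}.indicator
          (fun t => ENNReal.ofReal (Real.exp (s t / (4 * N)))) t) ∂P := by
        refine lintegral_mono fun t => ?_
        have h1 := exp_step_le hN (hs0 t) (hD t)
        by_cases hτ : s t ≤ τ
        · simp only [Set.indicator, Set.mem_ofPred_eq, hτ, if_true, and_true]
          split_ifs at h1 ⊢ with hNs
          · exact (ENNReal.ofReal_le_ofReal h1).trans le_add_self
          · rw [add_zero]
            exact ENNReal.ofReal_le_ofReal h1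
        · simp [Set.indicator, hτ]
    _ ≤ ENNReal.ofReal (1 + 2 / N) + ENNReal.ofReal (4 / N) := by
        rw [lintegral_add_right _ (Measurable.indicator (by fun_prop) hms),
          lintegral_indicator hms]
        gcongr
        rw [← ofReal_integral_eq_lintegral_ofReal hmaj
          (Filter.Eventually.of_forall fun t => step_majorant_nonneg hN (hs0 t) (hD t))]
        exact ENNReal.ofReal_le_ofReal hint
    _ ≤ _ := by
        rw [← ENNReal.ofReal_add (by positivity) (by positivity)]
        refine ENNReal.ofReal_le_ofReal ?_
        have := Real.add_one_le_exp (6 / N)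
        have e : 1 + 2 / N + 4 / N = 6 / N + 1 := by ring
        linarith

end Step

/-! ### The noise of the stochastic subgradients -/

section Ratio

variable {E : Type u} {Ξ : Type v} [NormedAddCommGroup E] [NormedSpace ℝ E]
  {G : E → Ξ → StrongDual ℝ E} {M : ℝ} {z : E}

/-- The squared norm of a stochastic subgradient relative to `M ^ 2`. -/
noncomputable def sqRatio (G : E → Ξ → StrongDual ℝ E) (M : ℝ) (z : E) (s : Ξ) : ℝ :=
  ‖G z s‖ ^ 2 / M ^ 2

lemma sqRatio_nonneg (s : Ξ) : 0 ≤ sqRatio G M z s := by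
  unfold sqRatio; positivity

lemma norm_eq_mul_sqrt_sqRatio (hM : 0 < M) (s : Ξ) :
    ‖G z s‖ = M * Real.sqrt (sqRatio G M z s) := by
  rw [sqRatio, ← div_pow, Real.sqrt_sq (by positivity), mul_div_cancel₀ _ hM.ne']

lemma measurable_sqRatio [MeasurableSpace E] [MeasurableSpace Ξ]
    (hG : Measurable (fun p : E × Ξ => G p.1 p.2)) :
    Measurable fun p : E × Ξ => sqRatio G M p.1 p.2 := by
  unfold sqRatio
  exact (hG.norm.pow_const 2).div_const _

lemma measurable_sqRatio_right [MeasurableSpace E] [MeasurableSpace Ξ]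
    (hG : Measurable (fun p : E × Ξ => G p.1 p.2)) (z : E) : Measurable (sqRatio G M z) := by
  have h : Measurable fun s : Ξ => G z s := hG.comp measurable_prodMk_left
  unfold sqRatio
  exact (h.norm.pow_const 2).div_const _

lemma measurableSet_exists_lt_sqRatio {Ω : Type w} [MeasurableSpace E] [MeasurableSpace Ξ]
    [MeasurableSpace Ω] (hG : Measurable (fun p : E × Ξ => G p.1 p.2)) {x : ℕ → Ω → E}
    {ξ : ℕ → Ω → Ξ} (hx : ∀ k, Measurable (x k)) (hξ : ∀ k, Measurable (ξ k)) (N : ℕ) (τ : ℝ) :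
    MeasurableSet {ω | ∃ k < N, τ < sqRatio G M (x k ω) (ξ k ω)} := by
  have hm : ∀ k, Measurable fun ω => sqRatio G M (x k ω) (ξ k ω) := fun k => by
    have h : Measurable fun ω => G (x k ω) (ξ k ω) := hG.comp ((hx k).prodMk (hξ k))
    unfold sqRatio
    exact (h.norm.pow_const 2).div_const _
  have e : {ω | ∃ k < N, τ < sqRatio G M (x k ω) (ξ k ω)}
      = ⋃ k, ⋃ _ : k < N, {ω | τ < sqRatio G M (x k ω) (ξ k ω)} := by ext ω; simp
  rw [e]
  exact MeasurableSet.iUnion fun k => MeasurableSet.iUnion fun _ =>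
    measurableSet_lt measurable_const (hm k)

lemma IsStochasticSubgradient.integrable_sqRatio [MeasurableSpace E] [MeasurableSpace Ξ]
    {P : Measure Ξ} {Q : Set E} {f : E → ℝ} (hG : IsStochasticSubgradient Q P f G M) (hM : 0 < M) (hz : z ∈ Q) :
    Integrable (sqRatio G M z) P ∧ ∫ s, sqRatio G M z s ∂P ≤ 1 := by
  have hm : Measurable (sqRatio G M z) :=
    measurable_sqRatio_right hG.measurable z
  have hle : ∫⁻ s, ENNReal.ofReal (sqRatio G M z s) ∂P ≤ 1 := by
    have h1 : ∀ s, ENNReal.ofReal (sqRatio G M z s)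
        = ENNReal.ofReal (‖G z s‖ ^ 2) * (ENNReal.ofReal (M ^ 2))⁻¹ := fun s => by
      rw [sqRatio, ENNReal.ofReal_div_of_pos (by positivity), div_eq_mul_inv]
    have h0 : ENNReal.ofReal (M ^ 2) ≠ 0 := by simp [hM.ne']
    simp_rw [h1]
    rw [lintegral_mul_const' _ _ (ENNReal.inv_ne_top.2 h0),
      ← ENNReal.mul_inv_cancel h0 ENNReal.ofReal_ne_top]
    gcongr
    exact hG.second_moment z hz
  have hint : Integrable (sqRatio G M z) P := by
    refine ⟨hm.aestronglyMeasurable, ?_⟩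
    rw [hasFiniteIntegral_iff_ofReal (Filter.Eventually.of_forall sqRatio_nonneg)]
    exact hle.trans_lt ENNReal.one_lt_top
  refine ⟨hint, ?_⟩
  rw [integral_eq_lintegral_of_nonneg_ae (Filter.Eventually.of_forall sqRatio_nonneg)
    hm.aestronglyMeasurable]
  exact ENNReal.toReal_le_of_le_ofReal zero_le_one (by simpa using hle)

end Ratio

lemma stronglyMeasurable_of_measurable_dual {E α : Type*} [NormedAddCommGroup E] [NormedSpace ℝ E]
    [FiniteDimensional ℝ E] [MeasurableSpace α] {g : α → StrongDual ℝ E} (hg : Measurable g) :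
    StronglyMeasurable g := by
  have : ProperSpace (StrongDual ℝ E) := FiniteDimensional.proper_real _
  exact hg.stronglyMeasurable

section Noise

variable {E : Type u} {Ξ : Type v} [NormedAddCommGroup E] [NormedSpace ℝ E]
  [FiniteDimensional ℝ E] [MeasurableSpace E] [MeasurableSpace Ξ] {P : Measure Ξ}
  [IsProbabilityMeasure P] {Q : Set E} {f : E → ℝ} {G : E → Ξ → StrongDual ℝ E} {M Rbar : ℝ}
  {y z : E}

/-- The error of a stochastic subgradient at `z` in the direction `z - y`, relative to
`M * Rbar`. -/
noncomputable def gradNoise {E : Type u} {Ξ : Type v} [NormedAddCommGroup E] [NormedSpace ℝ E]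
    [MeasurableSpace Ξ] (P : Measure Ξ) (G : E → Ξ → StrongDual ℝ E) (M Rbar : ℝ) (y z : E)
    (s : Ξ) : ℝ :=
  ((∫ t, G z t ∂P) - G z s) (z - y) / (M * Rbar)

lemma measurable_gradNoise [BorelSpace E]
    (hG : Measurable (fun p : E × Ξ => G p.1 p.2)) :
    Measurable fun p : E × Ξ => gradNoise P G M Rbar y p.1 p.2 := by
  have hmean : Measurable fun z => ∫ t, G z t ∂P :=
    (StronglyMeasurable.integral_prod_right' (ν := P)
      (stronglyMeasurable_of_measurable_dual hG)).measurable
  have : ProperSpace (StrongDual ℝ E) := FiniteDimensional.proper_real _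
  unfold gradNoise
  exact (measurable_dual_apply ((hmean.comp measurable_fst).sub hG)
    (measurable_fst.sub_const y)).div_const _

lemma IsStochasticSubgradient.integrable (hG : IsStochasticSubgradient Q P f G M)
    (hM : 0 < M) (hz : z ∈ Q) : Integrable (G z) P ∧ ‖∫ s, G z s ∂P‖ ≤ M := by
  obtain ⟨hi, h1⟩ := hG.integrable_sqRatio hM hz
  have hb : ∀ s, ‖G z s‖ ≤ M / 2 * (1 + sqRatio G M z s) := fun s => by
    rw [norm_eq_mul_sqrt_sqRatio hM]
    nlinarith [sq_nonneg (Real.sqrt (sqRatio G M z s) - 1), Real.sq_sqrt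
      (sqRatio_nonneg (G := G) (M := M) (z := z) s)]
  have hbi : Integrable (fun s => M / 2 * (1 + sqRatio G M z s)) P :=
    ((integrable_const _).add hi).const_mul _
  refine ⟨hbi.mono' (stronglyMeasurable_of_measurable_dual
    (hG.measurable.comp measurable_prodMk_left)).aestronglyMeasurable
    (Filter.Eventually.of_forall hb), ?_⟩
  refine (norm_integral_le_of_norm_le hbi (Filter.Eventually.of_forall hb)).trans ?_
  rw [integral_const_mul, integral_add (integrable_const _) hi]
  simp only [integral_const, probReal_univ, smul_eq_mul, mul_one]
  nlinarith

lemma IsStochasticSubgradient.integral_gradNoise (hG : IsStochasticSubgradient Q P f G M)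
    (hM : 0 < M) (hz : z ∈ Q) : Integrable (gradNoise P G M Rbar y z) P ∧
      ∫ s, gradNoise P G M Rbar y z s ∂P = 0 := by
  obtain ⟨hi, -⟩ := hG.integrable hM hz
  have hia : Integrable (fun s => G z s (z - y)) P := hi.apply_continuousLinearMap (z - y)
  have hi2 : Integrable (fun s => (∫ t, G z t ∂P) (z - y) - G z s (z - y)) P :=
    (integrable_const _).sub hia
  unfold gradNoise
  simp only [_root_.sub_apply]
  refine ⟨hi2.div_const _, ?_⟩
  rw [integral_div, integral_sub (integrable_const _) hia,
    ContinuousLinearMap.integral_apply hi]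
  simp

lemma IsStochasticSubgradient.abs_gradNoise_le (hG : IsStochasticSubgradient Q P f G M)
    (hM : 0 < M) (hR : 0 < Rbar) (hz : z ∈ Q) (hzy : ‖z - y‖ ≤ Real.sqrt 2 * Rbar) (s : Ξ) :
    |gradNoise P G M Rbar y z s| ≤ 3 / 2 * (1 + Real.sqrt (sqRatio G M z s)) := by
  have h1 : ‖(∫ t, G z t ∂P) - G z s‖ ≤ M * (1 + Real.sqrt (sqRatio G M z s)) := by
    refine (norm_sub_le _ _).trans ?_
    rw [norm_eq_mul_sqrt_sqRatio hM s]
    linarith [(hG.integrable hM hz).2]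
  have h2 : Real.sqrt 2 ≤ 3 / 2 := by
    rw [Real.sqrt_le_left (by norm_num)]; norm_num
  rw [gradNoise, abs_div, abs_of_pos (by positivity : 0 < M * Rbar), div_le_iff₀ (by positivity)]
  calc |((∫ t, G z t ∂P) - G z s) (z - y)|
      ≤ ‖(∫ t, G z t ∂P) - G z s‖ * ‖z - y‖ :=
        ((∫ t, G z t ∂P) - G z s).le_opNorm (z - y)
    _ ≤ (M * (1 + Real.sqrt (sqRatio G M z s))) * (3 / 2 * Rbar) := by
        gcongr
        exact hzy.trans (by gcongr)
    _ = _ := by ring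

end Noise

/-! ### The exponential moment of a run -/

section RunMoment

variable {E : Type u} {Ξ : Type v} {Ω : Type w} [NormedAddCommGroup E] [NormedSpace ℝ E]
  [FiniteDimensional ℝ E] [MeasurableSpace E] [BorelSpace E] [MeasurableSpace Ξ]
  [MeasurableSpace Ω] {μ : Measure Ω} [IsProbabilityMeasure μ] {Q : Set E} {P : Measure Ξ}
  [IsProbabilityMeasure P] {f d : E → ℝ} {G : E → Ξ → StrongDual ℝ E} {M R Rbar τ : ℝ}
  {x₀ y : E} {N : ℕ} {ξ : ℕ → Ω → Ξ} {x : ℕ → Ω → E}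

/-- On the event that no stochastic subgradient of the run exceeds the level `τ`, the normalised
optimality gap of the output has an exponential moment bounded by an absolute constant. -/
lemma IsSMDRun.lintegral_exp_gap_le
    (hrun : IsSMDRun μ Q P d G (R / M * Real.sqrt (2 / N)) x₀ ξ x)
    (hQ : Convex ℝ Q) (hQc : IsCompact Q) (hd : IsProxFunction Q d) (hM : 0 < M)
    (hG : IsStochasticSubgradient Q P f G M) (hx₀ : x₀ ∈ Q) (hy : y ∈ Q) (hR : 0 < R)
    (hRR : R ≤ Rbar) (hV : bregman Q d x₀ y ≤ R ^ 2)
    (hVbar : ∀ z ∈ Q, bregman Q d z y ≤ Rbar ^ 2) (hN : 0 < N)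
    (htail : ∀ z ∈ Q, ∫⁻ t in {t | N < sqRatio G M z t ∧ sqRatio G M z t ≤ τ},
      ENNReal.ofReal (Real.exp (sqRatio G M z t / (4 * N))) ∂P ≤ ENNReal.ofReal (4 / N)) :
    ∫⁻ ω in {ω | ∃ k < N, τ < sqRatio G M (x k ω) (ξ k ω)}ᶜ,
      ENNReal.ofReal (Real.exp (Real.sqrt N / (M * Rbar) * (f (smdOutput x N ω) - f y) / 16)) ∂μ
      ≤ ENNReal.ofReal (Real.exp 7) := by
  have hN1 : (1 : ℝ) ≤ N := by exact_mod_cast hN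
  have hN0 : (0 : ℝ) < N := by linarith
  have hRb : 0 < Rbar := hR.trans_le hRR
  have hSm := measurable_sqRatio (M := M) hG.measurable
  have hDm := measurable_gradNoise (P := P) (M := M) (Rbar := Rbar) (y := y) hG.measurable
  let w : E × Ξ → ℝ≥0∞ := {p | sqRatio G M p.1 p.2 ≤ τ}.indicator fun p =>
    ENNReal.ofReal (Real.exp ((sqRatio G M p.1 p.2 / N
      + gradNoise P G M Rbar y p.1 p.2 / Real.sqrt N) / 16))
  have hw : Measurable w :=
    Measurable.indicator (by fun_prop) (measurableSet_le hSm measurable_const)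
  have hb : ∀ z ∈ Q, ∫⁻ s, w (z, s) ∂P ≤ ENNReal.ofReal (Real.exp (6 / N)) := by
    intro z hz
    obtain ⟨hsi, hs1⟩ := hG.integrable_sqRatio hM hz
    obtain ⟨hDi, hD0⟩ := hG.integral_gradNoise (Rbar := Rbar) (y := y) hM hz
    exact lintegral_exp_step_le hN1 sqRatio_nonneg (measurable_sqRatio_right hG.measurable z) hsi hs1 hDi hD0
      (hG.abs_gradNoise_le hM hRb hz
        (norm_sub_le_of_bregman_le hQ hd hRb.le hz hy (hVbar z hz))) (htail z hz)
  have hmB := (measurableSet_exists_lt_sqRatio (M := M) hG.measurable hrun.measurable_iterate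
    hrun.measurable_sample N τ).compl
  rw [← lintegral_indicator hmB]
  calc _ ≤ ∫⁻ ω, ENNReal.ofReal (Real.exp 1) * ∏ k ∈ Finset.range N, w (x k ω, ξ k ω) ∂μ := by
        refine lintegral_mono fun ω => ?_
        refine Set.indicator_le' (s := {ω | ∃ k < N, τ < sqRatio G M (x k ω) (ξ k ω)}ᶜ)
          (g := fun ω => ENNReal.ofReal (Real.exp 1) * ∏ k ∈ Finset.range N, w (x k ω, ξ k ω))
          (fun ω hω => ?_) (fun _ _ => zero_le) ω
        have hle : ∀ k ∈ Finset.range N, sqRatio G M (x k ω) (ξ k ω) ≤ τ := by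
          simpa using hω
        have hprod : ∏ k ∈ Finset.range N, w (x k ω, ξ k ω) = ENNReal.ofReal (Real.exp
            (∑ k ∈ Finset.range N, (sqRatio G M (x k ω) (ξ k ω) / N
              + gradNoise P G M Rbar y (x k ω) (ξ k ω) / Real.sqrt N) / 16)) := by
          rw [Real.exp_sum, ENNReal.ofReal_prod_of_nonneg fun _ _ => (Real.exp_pos _).le]
          refine Finset.prod_congr rfl fun k hk => ?_
          have hmem : (x k ω, ξ k ω) ∈ {p : E × Ξ | sqRatio G M p.1 p.2 ≤ τ} := by
            rw [Set.mem_ofPred_eq]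
            exact hle k hk
          exact Set.indicator_of_mem hmem _
        have hgap := normalized_gap_le (f := f) (x := fun k => x k ω)
          (g := fun k => G (x k ω) (ξ k ω)) (f' := fun z => ∫ t, G z t ∂P) hQ hd hG.mean_mem hM hR
          hRR hN (fun k => hrun.mem hx₀ k ω) hy (by rw [hrun.start]; exact hV)
          (fun k => hrun.step k ω)
        rw [hprod, ← ENNReal.ofReal_mul (Real.exp_pos _).le, ← Real.exp_add]
        refine ENNReal.ofReal_le_ofReal (Real.exp_le_exp.2 ?_)
        rw [← Finset.sum_div]
        unfold smdOutput sqRatio gradNoise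
        linarith
    _ ≤ ENNReal.ofReal (Real.exp 1) * ENNReal.ofReal (Real.exp (6 / N)) ^ N := by
        rw [lintegral_const_mul' _ _ ENNReal.ofReal_ne_top]
        gcongr
        exact hrun.lintegral_prod_le hQ hQc hd hG.measurable hx₀ hw hb N
    _ = ENNReal.ofReal (Real.exp 7) := by
        rw [← ENNReal.ofReal_pow (Real.exp_pos _).le, ← Real.exp_nat_mul,
          ← ENNReal.ofReal_mul (Real.exp_pos _).le, ← Real.exp_add,
          mul_div_cancel₀ _ hN0.ne']
        norm_num

end RunMoment

/-! ### The tail assumptions -/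

section Tails

variable {E : Type u} {Ξ : Type v} [NormedAddCommGroup E] [NormedSpace ℝ E] [MeasurableSpace Ξ]
  {Q : Set E} {P : Measure Ξ} {G : E → Ξ → StrongDual ℝ E} {M σ : ℝ} {N K : ℕ}

lemma TailBounded.tailLight [IsProbabilityMeasure P] (hM : 0 < M) (h : TailBounded Q P G M) :
    TailLight Q P G M := by
  intro z hz
  calc ∫⁻ s, ENNReal.ofReal (Real.exp (‖G z s‖ ^ 2 / M ^ 2)) ∂P
      ≤ ∫⁻ _, ENNReal.ofReal (Real.exp 1) ∂P := by
        refine lintegral_mono_ae ?_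
        filter_upwards [h z hz] with s hs
        refine ENNReal.ofReal_le_ofReal (Real.exp_le_exp.2 ?_)
        rw [div_le_one (by positivity)]
        gcongr
    _ = _ := by simp

/-- The tail condition shared by all three assumptions: at a suitable level `τ`, the subgradients
with `N < ‖G‖² / M² ≤ τ` contribute `O(1 / N)` to the exponential moment of a step, and the level
`τ` is exceeded during the `N` steps of a run with probability at most `σ / (4 K)`. -/
def TailControlled (Q : Set E) (P : Measure Ξ) (G : E → Ξ → StrongDual ℝ E) (M σ : ℝ) (N K : ℕ)
    (τ : ℝ) : Prop :=
  (∀ z ∈ Q, ∫⁻ t in {t | N < sqRatio G M z t ∧ sqRatio G M z t ≤ τ},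
    ENNReal.ofReal (Real.exp (sqRatio G M z t / (4 * N))) ∂P ≤ ENNReal.ofReal (4 / N)) ∧
  ∀ z ∈ Q, P {t | τ < sqRatio G M z t} ≤ ENNReal.ofReal (σ / (4 * K) / N)

lemma TailLight.exists_tailControlled [MeasurableSpace E]
    (hG : Measurable (fun p : E × Ξ => G p.1 p.2))
    (h : TailLight Q P G M) (hσ : 0 < σ) (hN : 0 < N) (hK : 0 < K) :
    ∃ τ, TailControlled Q P G M σ N K τ := by
  have hN1 : (1 : ℝ) ≤ N := by exact_mod_cast hN
  have hN0 : (0 : ℝ) < N := by linarith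
  have hK0 : (0 : ℝ) < K := by exact_mod_cast hK
  have hp : 0 < σ / (4 * K) / N := by positivity
  have hm : ∀ z, Measurable (sqRatio G M z) := measurable_sqRatio_right hG
  refine ⟨1 - Real.log (σ / (4 * K) / N), fun z hz => ?_, fun z hz => ?_⟩
  · have hms : MeasurableSet {t | (N : ℝ) < sqRatio G M z t ∧
        sqRatio G M z t ≤ 1 - Real.log (σ / (4 * K) / N)} :=
      (measurableSet_lt measurable_const (hm z)).inter (measurableSet_le (hm z) measurable_const)
    calc _ ≤ ∫⁻ t in {t | (N : ℝ) < sqRatio G M z t ∧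
            sqRatio G M z t ≤ 1 - Real.log (σ / (4 * K) / N)},
          ENNReal.ofReal (4 / (3 * N)) * ENNReal.ofReal (Real.exp (sqRatio G M z t)) ∂P := by
          refine setLIntegral_mono' hms fun t ht => ?_
          rw [← ENNReal.ofReal_mul (by positivity)]
          refine ENNReal.ofReal_le_ofReal ?_
          -- `exp (s / 4) = exp s / exp (3 s / 4)`, and `exp (3 s / 4) ≥ 3 N / 4` for `s > N`.
          have h1 : 3 * N / 4 ≤ Real.exp (3 / 4 * sqRatio G M z t) := by
            linarith [Real.add_one_le_exp (3 / 4 * sqRatio G M z t), ht.1]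
          have h2 : Real.exp (sqRatio G M z t / (4 * N)) ≤ Real.exp (sqRatio G M z t / 4) := by
            refine Real.exp_le_exp.2 ?_
            have := sqRatio_nonneg (G := G) (M := M) (z := z) t
            gcongr
            linarith
          have h3 : Real.exp (sqRatio G M z t) =
              Real.exp (3 / 4 * sqRatio G M z t) * Real.exp (sqRatio G M z t / 4) := by
            rw [← Real.exp_add]; ring_nf
          refine h2.trans ?_
          rw [h3, div_mul_eq_mul_div, le_div_iff₀ (by positivity)]
          nlinarith [Real.exp_pos (sqRatio G M z t / 4)]
      _ ≤ ∫⁻ t, ENNReal.ofReal (4 / (3 * N)) * ENNReal.ofReal (Real.exp (sqRatio G M z t)) ∂P :=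
          setLIntegral_le_lintegral _ _
      _ ≤ ENNReal.ofReal (4 / (3 * N)) * ENNReal.ofReal (Real.exp 1) := by
          rw [lintegral_const_mul' _ _ ENNReal.ofReal_ne_top]
          gcongr
          exact h z hz
      _ ≤ _ := by
          rw [← ENNReal.ofReal_mul (by positivity)]
          refine ENNReal.ofReal_le_ofReal ?_
          rw [div_mul_eq_mul_div, div_le_div_iff₀ (by positivity) hN0]
          nlinarith [Real.exp_one_lt_d9]
  · calc P {t | 1 - Real.log (σ / (4 * K) / N) < sqRatio G M z t}
        ≤ P {t | ENNReal.ofReal (Real.exp (1 - Real.log (σ / (4 * K) / N))) ≤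
            ENNReal.ofReal (Real.exp (sqRatio G M z t))} :=
          measure_mono fun t ht => ENNReal.ofReal_le_ofReal (Real.exp_le_exp.2 (le_of_lt ht))
      _ ≤ (∫⁻ t, ENNReal.ofReal (Real.exp (sqRatio G M z t)) ∂P) /
            ENNReal.ofReal (Real.exp (1 - Real.log (σ / (4 * K) / N))) :=
          meas_ge_le_lintegral_div (by have := hm z; fun_prop) (by simp [Real.exp_pos]) (by simp)
      _ ≤ ENNReal.ofReal (Real.exp 1) /
            ENNReal.ofReal (Real.exp (1 - Real.log (σ / (4 * K) / N))) := by
          gcongr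
          exact h z hz
      _ = _ := by
          rw [← ENNReal.ofReal_div_of_pos (Real.exp_pos _), ← Real.exp_sub, sub_sub_cancel,
            Real.exp_log hp]

/-- For polynomial tails the level is `τ = 2 K N`: then `exp (τ / (4 N)) = exp (K / 2)` is of order
`1 / σ ≤ N ^ (α - 1)`, which the tail probability `N ^ (-α)` compensates up to `1 / N`. -/
lemma TailPolynomial.tailControlled {α : ℝ} (h : TailPolynomial Q P G M α) (hα : 2 < α)
    (hσ : 0 < σ) (hN : 0 < N) (hK : 0 < K) (hKσ : Real.exp (K / 2) * σ ≤ Real.exp 1)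
    (hσN : (1 / σ) ^ (1 / (α - 1)) ≤ (N : ℝ)) : TailControlled Q P G M σ N K (2 * K * N) := by
  have hN1 : (1 : ℝ) ≤ N := by exact_mod_cast hN
  have hN0 : (0 : ℝ) < N := by linarith
  have hK1 : (1 : ℝ) ≤ K := by exact_mod_cast hK
  have hK0 : (0 : ℝ) < K := by linarith
  have hNα : N / σ ≤ (N : ℝ) ^ α := by
    have h1 : 1 / σ ≤ (N : ℝ) ^ (α - 1) := by
      have h2 := Real.rpow_le_rpow (by positivity) hσN (by linarith : 0 ≤ α - 1)
      rwa [← Real.rpow_mul (by positivity), one_div_mul_cancel (by linarith), Real.rpow_one] at h2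
    have h3 : (N : ℝ) ^ α = N * (N : ℝ) ^ (α - 1) := by
      rw [Real.rpow_sub hN0, Real.rpow_one, mul_div_cancel₀ _ hN0.ne']
    rw [h3, div_eq_mul_one_div]
    gcongr
  refine ⟨fun z hz => ?_, fun z hz => ?_⟩
  · calc _ ≤ ∫⁻ t in {t | (N : ℝ) < sqRatio G M z t ∧ sqRatio G M z t ≤ 2 * K * N},
          ENNReal.ofReal (Real.exp (K / 2)) ∂P := by
          refine setLIntegral_mono measurable_const fun t ht => ?_
          refine ENNReal.ofReal_le_ofReal (Real.exp_le_exp.2 ?_)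
          rw [div_le_iff₀ (by positivity)]
          linarith [ht.2]
      _ = ENNReal.ofReal (Real.exp (K / 2)) *
            P {t | (N : ℝ) < sqRatio G M z t ∧ sqRatio G M z t ≤ 2 * K * N} :=
          setLIntegral_const _ _
      _ ≤ ENNReal.ofReal (Real.exp (K / 2)) * ENNReal.ofReal (1 / (N + 1 : ℝ) ^ α) := by
          gcongr
          exact (measure_mono fun t ht => le_of_lt ht.1).trans (h z hz N hN0.le)
      _ ≤ _ := by
          rw [← ENNReal.ofReal_mul (Real.exp_pos _).le]
          refine ENNReal.ofReal_le_ofReal ?_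
          have h1 : N / σ ≤ (N + 1 : ℝ) ^ α :=
            hNα.trans (Real.rpow_le_rpow hN0.le (by linarith) (by linarith))
          rw [mul_one_div, div_le_div_iff₀ (by positivity) hN0]
          have h2 : Real.exp (K / 2) ≤ Real.exp 1 / σ := (le_div_iff₀ hσ).2 hKσ
          calc Real.exp (K / 2) * N ≤ Real.exp 1 / σ * N := by gcongr
            _ = Real.exp 1 * (N / σ) := by ring
            _ ≤ 4 * (N + 1 : ℝ) ^ α := by
                gcongr
                linarith [Real.exp_one_lt_d9]
  · have hsub : {t | 2 * K * N < sqRatio G M z t} ⊆ {t | 2 * K * N ≤ ‖G z t‖ ^ 2 / M ^ 2} :=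
      fun t (ht : 2 * K * N < sqRatio G M z t) => ht.le
    refine (measure_mono hsub).trans
      ((h z hz (2 * K * N) (by positivity)).trans (ENNReal.ofReal_le_ofReal ?_))
    have h1 : (4 * K) * (N / σ) ≤ (2 * K * N + 1 : ℝ) ^ α := by
      calc (4 * K : ℝ) * (N / σ) ≤ (2 * K) ^ 2 * (N / σ) := by
            gcongr
            nlinarith
        _ ≤ (2 * K : ℝ) ^ α * (N : ℝ) ^ α := by
            gcongr
            rw [← Real.rpow_natCast]
            exact Real.rpow_le_rpow_of_exponent_le (by linarith) (by exact_mod_cast hα.le)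
        _ = (2 * K * N : ℝ) ^ α := (Real.mul_rpow (by positivity) hN0.le).symm
        _ ≤ _ := Real.rpow_le_rpow (by positivity) (by linarith) (by linarith)
    have e : σ / (4 * K) / N = 1 / ((4 * K) * (N / σ)) := by field_simp
    rw [e]
    gcongr

end Tails

/-! ### Confidence of the averaged output -/

lemma LowerSemicontinuousOn.measurable_indicator {E : Type*} [TopologicalSpace E]
    [MeasurableSpace E] [BorelSpace E] {Q : Set E} {f : E → ℝ} (hQ : MeasurableSet Q)
    (hf : LowerSemicontinuousOn f Q) : Measurable (Q.indicator f) := by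
  refine measurable_of_restrict_of_restrict_compl hQ ?_ ?_
  · have e : Q.domRestrict (Q.indicator f) = Q.domRestrict f := by ext ⟨z, hz⟩; simp [hz]
    rw [e]
    exact (lowerSemicontinuous_restrict_iff.2 hf).measurable
  · have e : Qᶜ.domRestrict (Q.indicator f) = fun _ => 0 := by
      ext ⟨z, hz⟩; exact Set.indicator_of_notMem hz f
    rw [e]
    exact measurable_const

/-- The conclusion under the common tail condition, with the constant `1760 ^ 2`. -/
lemma isEpsSigmaSolution_of_tailControlled {E : Type u} {Ξ : Type v} {Ω : Type w}
    [NormedAddCommGroup E] [NormedSpace ℝ E] [FiniteDimensional ℝ E] [MeasurableSpace E]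
    [BorelSpace E] [MeasurableSpace Ξ] [MeasurableSpace Ω] {μ : Measure Ω} [IsProbabilityMeasure μ]
    {P : Measure Ξ} [IsProbabilityMeasure P] {Q : Set E} {f d : E → ℝ}
    {G : E → Ξ → StrongDual ℝ E} {M R Rbar ε σ τ : ℝ} {x₀ xstar : E} {K N : ℕ}
    {ξ : Fin K → ℕ → Ω → Ξ} {x : Fin K → ℕ → Ω → E} (hQ : Convex ℝ Q) (hQc : IsCompact Q)
    (hM : 0 < M) (hG : IsStochasticSubgradient Q P f G M) (hd : IsProxFunction Q d) (hx₀ : x₀ ∈ Q)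
    (hxs : xstar ∈ Q) (hmin : IsMinOn f Q xstar) (hR : 0 < R) (hRR : R ≤ Rbar)
    (hV : bregman Q d x₀ xstar ≤ R ^ 2) (hVbar : ∀ z ∈ Q, bregman Q d z xstar ≤ Rbar ^ 2)
    (hε : 0 < ε) (hσ : 0 < σ) (hK : 0 < K) (hσK : Real.exp (-(K / 2)) ≤ σ)
    (hKσ : Real.exp (K / 2) * σ ≤ Real.exp 1) (hN : 0 < N)
    (hNε : 4 * 1760 ^ 2 * M ^ 2 * Rbar ^ 2 / ε ^ 2 ≤ N) (hτ : TailControlled Q P G M σ N K τ)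
    (hrun : ∀ i, IsSMDRun μ Q P d G (R / M * Real.sqrt (2 / N)) x₀ (ξ i) (x i))
    (hind : iIndepFun (fun i => smdOutput (x i) N) μ) :
    IsEpsSigmaSolution μ Q f ε σ (fun ω => (1 / (K : ℝ)) • ∑ i, smdOutput (x i) N ω) := by
  have hN0 : (0 : ℝ) < N := by exact_mod_cast hN
  have hK0 : (0 : ℝ) < K := by exact_mod_cast hK
  have hRb : 0 < Rbar := hR.trans_le hRR
  have : Nonempty (Fin K) := ⟨⟨0, hK⟩⟩
  have hout : ∀ i ω, smdOutput (x i) N ω ∈ Q := fun i ω => by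
    have := (map_average_le_of_subdifferentialOn (f := f) (x := fun k => x i k ω) hQ hG.mean_mem
      (Finset.nonempty_range_iff.2 hN.ne') (fun k _ => (hrun i).mem hx₀ k ω)).1
    rwa [Finset.card_range] at this
  have havg : ∀ ω, (1 / (K : ℝ)) • ∑ i, smdOutput (x i) N ω ∈ Q ∧
      f ((1 / (K : ℝ)) • ∑ i, smdOutput (x i) N ω) ≤
        (1 / (K : ℝ)) * ∑ i, f (smdOutput (x i) N ω) := fun ω => by
    have := map_average_le_of_subdifferentialOn (f := f) (x := fun i => smdOutput (x i) N ω) hQ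
      hG.mean_mem (Finset.univ_nonempty (α := Fin K)) (fun i _ => hout i ω)
    rwa [Finset.card_univ, Fintype.card_fin] at this
  refine ⟨fun ω => (havg ω).1, ?_⟩
  have hinf : sInf (f '' Q) = f xstar := by
    refine IsLeast.csInf_eq ⟨⟨xstar, hxs, rfl⟩, ?_⟩
    rintro _ ⟨z, hz, rfl⟩
    exact hmin hz
  rw [hinf]
  set c := Real.sqrt N / (M * Rbar) with hc
  have hc0 : 0 < c := by positivity
  let φ : E → ℝ := fun z => c * (Q.indicator f z - f xstar)
  have hφm : Measurable φ := (((lowerSemicontinuousOn_of_subdifferentialOn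
    hG.mean_mem).measurable_indicator hQc.measurableSet).sub_const _).const_mul c
  have hφ : ∀ i ω, φ (smdOutput (x i) N ω) = c * (f (smdOutput (x i) N ω) - f xstar) :=
    fun i ω => by simp only [φ, Set.indicator_of_mem (hout i ω)]
  have hom : ∀ i, Measurable (smdOutput (x i) N) := fun i => by
    have : ProperSpace E := FiniteDimensional.proper_real E
    unfold smdOutput
    exact (Finset.measurable_fun_sum _ fun k _ => (hrun i).measurable_iterate k).const_smul _
  have hSm := measurable_sqRatio (M := M) hG.measurable
  have hmB := fun i => (measurableSet_exists_lt_sqRatio (M := M) hG.measurable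
    (hrun i).measurable_iterate (hrun i).measurable_sample N τ).compl
  have hmain := measure_sum_ge_le (μ := μ) (Y := fun i ω => φ (smdOutput (x i) N ω))
    (B := fun i => {ω | ∃ k < N, τ < sqRatio G M (x i k ω) (ξ i k ω)}ᶜ) hK hσ hσK hKσ
    (fun i => hφm.comp (hom i))
    (fun i ω => by
      simp only [hφ]
      exact mul_nonneg hc0.le (sub_nonneg.2 (hmin (hout i ω))))
    (hind.comp (fun _ => φ) (fun _ => hφm)) hmB
    (fun i => by
      rw [compl_compl]
      have hA : MeasurableSet {p : E × Ξ | τ < sqRatio G M p.1 p.2} :=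
        measurableSet_lt measurable_const hSm
      have := (hrun i).measure_exists_le hQ hQc hd hG.measurable hx₀ hA
        (δ := ENNReal.ofReal (σ / (4 * K) / N)) (by simpa using hτ.2) N
      simp only [Set.mem_ofPred_eq] at this
      refine this.trans_eq ?_
      rw [← ENNReal.ofReal_natCast, ← ENNReal.ofReal_mul hN0.le, mul_div_cancel₀ _ hN0.ne'])
    (fun i => by
      simp only [hφ]
      exact (hrun i).lintegral_exp_gap_le hQ hQc hd hM hG hx₀ hxs hR hRR hV hVbar hN hτ.1)
  refine (measure_mono fun ω hω => ?_).trans hmain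
  have hω' : ε ≤ f ((1 / (K : ℝ)) • ∑ i, smdOutput (x i) N ω) - f xstar := hω
  rw [Set.mem_ofPred_eq]
  simp only [hφ]
  rw [← Finset.mul_sum, Finset.sum_sub_distrib, Finset.sum_const, Finset.card_univ,
    Fintype.card_fin, nsmul_eq_mul]
  have h1 : K * ε ≤ ∑ i, f (smdOutput (x i) N ω) - K * f xstar := by
    have h2 := (havg ω).2
    rw [one_div_mul_eq_div, le_div_iff₀ hK0] at h2
    nlinarith
  -- The number of steps makes the normalised accuracy `c * ε` at least `3520`.
  have h3 : 3520 ≤ c * ε := by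
    have h4 : 3520 * (M * Rbar) / ε ≤ Real.sqrt N := by
      refine Real.le_sqrt_of_sq_le (le_trans (le_of_eq ?_) hNε)
      field_simp
      norm_num
    rw [hc, div_mul_eq_mul_div, le_div_iff₀ (by positivity)]
    exact (div_le_iff₀ hε).1 h4
  calc 3520 * (K : ℝ) ≤ c * ε * K := by gcongr
    _ = c * (K * ε) := by ring
    _ ≤ _ := by gcongr

/-! ### The three tail assumptions with one constant -/

theorem mainTheorem1 :
    ∃ (Ca Cb : ℝ) (Cc : ℝ → ℝ), 0 < Ca ∧ 0 < Cb ∧ (∀ α : ℝ, 2 < α → 0 < Cc α) ∧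
    ∀ (E : Type u) (Ξ : Type v) (Ω : Type w)
      [NormedAddCommGroup E] [NormedSpace ℝ E] [FiniteDimensional ℝ E]
      [MeasurableSpace E] [BorelSpace E] [MeasurableSpace Ξ] [MeasurableSpace Ω]
      (μ : Measure Ω) [IsProbabilityMeasure μ] (P : Measure Ξ) [IsProbabilityMeasure P]
      (Q : Set E) (F : E → Ξ → ℝ) (G : E → Ξ → StrongDual ℝ E) (d : E → ℝ)
      (M R Rbar ε σ C : ℝ) (x₀ xstar : E) (K N : ℕ)
      (ξ : Fin K → ℕ → Ω → Ξ) (x : Fin K → ℕ → Ω → E),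
      IsStochasticProblem Q P F →
      0 < M →
      IsStochasticSubgradient Q P (objective P F) G M →
      IsProxFunction Q d →
      -- the starting point and a solution of the problem
      x₀ ∈ Q → IsMinOn d Q x₀ →
      xstar ∈ Q → IsMinOn (objective P F) Q xstar →
      -- the two radii
      0 < R → R ≤ Rbar →
      bregman Q d x₀ xstar ≤ R ^ 2 →
      (∀ z ∈ Q, bregman Q d z xstar ≤ Rbar ^ 2) →
      0 < ε → 0 < σ → σ < 1 →
      -- one of the three tail assumptions, with its constant
      ((C = Ca ∧ TailBounded Q P G M) ∨
        (C = Cb ∧ TailLight Q P G M ∧ Real.log (1 / σ) ≤ N) ∨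
        (∃ α : ℝ, 2 < α ∧ C = Cc α ∧ TailPolynomial Q P G M α ∧
          (1 / σ) ^ (1 / (α - 1)) ≤ (N : ℝ))) →
      K = ⌈2 * Real.log (1 / σ)⌉₊ →
      N = ⌈4 * C * M ^ 2 * Rbar ^ 2 / ε ^ 2⌉₊ →
      (∀ i, IsSMDRun μ Q P d G (R / M * Real.sqrt (2 / N)) x₀ (ξ i) (x i)) →
      iIndepFun (fun i => smdOutput (x i) N) μ →
      IsEpsSigmaSolution μ Q (objective P F) ε σ
        (fun ω => (1 / (K : ℝ)) • ∑ i, smdOutput (x i) N ω) := by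
  refine ⟨1760 ^ 2, 1760 ^ 2, fun _ => 1760 ^ 2, by norm_num, by norm_num, fun _ _ => by norm_num,
    ?_⟩
  intro E Ξ Ω _ _ _ _ _ _ _ μ _ P _ Q F G d M R Rbar ε σ C x₀ xstar K N ξ x hprob hM hG hd hx₀ _
    hxs hmin hR hRR hV hVbar hε hσ hσ1 htail hKdef hNdef hrun hind
  have hC : C = 1760 ^ 2 := by
    rcases htail with h | h | ⟨_, _, h, _⟩
    exacts [h.1, h.1, h]
  subst hC
  have hRb : 0 < Rbar := hR.trans_le hRR
  have hlog : 0 < Real.log (1 / σ) := Real.log_pos (by rw [lt_div_iff₀ hσ]; linarith)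
  have hlog' : Real.log (1 / σ) = -Real.log σ := by rw [one_div, Real.log_inv]
  have hK : 0 < K := by rw [hKdef]; exact Nat.ceil_pos.2 (by positivity)
  have hN : 0 < N := by rw [hNdef]; exact Nat.ceil_pos.2 (by positivity)
  have hKge : 2 * Real.log (1 / σ) ≤ K := by rw [hKdef]; exact Nat.le_ceil _
  have hKlt : (K : ℝ) < 2 * Real.log (1 / σ) + 1 := by
    rw [hKdef]; exact Nat.ceil_lt_add_one (by positivity)
  have hNge : 4 * 1760 ^ 2 * M ^ 2 * Rbar ^ 2 / ε ^ 2 ≤ (N : ℝ) := by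
    rw [hNdef]; exact Nat.le_ceil _
  have hσK : Real.exp (-(K / 2)) ≤ σ := by
    rw [← Real.le_log_iff_exp_le hσ]; linarith
  have hKσ : Real.exp (K / 2) * σ ≤ Real.exp 1 := by
    have h := Real.exp_le_exp.2 (by linarith : K / 2 + Real.log σ ≤ 1)
    rwa [Real.exp_add, Real.exp_log hσ] at h
  obtain ⟨τ, hτ⟩ : ∃ τ, TailControlled Q P G M σ N K τ := by
    rcases htail with ⟨-, h⟩ | ⟨-, h, -⟩ | ⟨α, hα, -, h, hσN⟩
    · exact (h.tailLight hM).exists_tailControlled hG.measurable hσ hN hK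
    · exact h.exists_tailControlled hG.measurable hσ hN hK
    · exact ⟨_, h.tailControlled hα hσ hN hK hKσ hσN⟩
  exact isEpsSigmaSolution_of_tailControlled hprob.convex_set hprob.compact_set hM hG hd hx₀ hxs
    hmin hR hRR hV hVbar hε hσ hK hσK hKσ hN hNge hτ hrun hind
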